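/- Let $p$ be a prime, let $R$ be a complete discrete valuation ring whose residue field $k$ has characteristic $p$, and let $K$ be the fraction field of $R$ (so $K$ is a complete discrete valuation field, of characteristic $0$ or $p$; $k$ is not assumed perfect). Let $K^{\mathrm{sep}}$ be a separable closure of $K$, let $K^{\mathrm{un}} \subseteq K^{\mathrm{sep}}$ be the compositum of all finite unramified subextensions of $K^{\mathrm{sep}}/K$, and let $\overline{k}$ be the residue field of the integral closure $\mathcal{O}_{K^{\mathrm{sep}}}$ of $R$ in $K^{\mathrm{sep}}$ (a local ring). Galois groups carry the Krull topology; $\mathrm{Gal}(\overline{k}/k)$ denotes the group of $k$-automorphisms of $\overline{k}$. Then: 1. The restriction map $\mathrm{Gal}(K^{\mathrm{sep}}/K) \to \mathrm{Gal}(K^{\mathrm{un}}/K)$ splits: there is a continuous group homomorphism $s : \mathrm{Gal}(K^{\mathrm{un}}/K) \to \mathrm{Gal}(K^{\mathrm{sep}}/K)$ with $s(\sigma)|_{K^{\mathrm{un}}} = \sigma$ for all $\sigma$. 2. The field $\overline{k}$ is an algebraic closure of $k$, and there is an isomorphism of topological groups $\mathrm{Gal}(K^{\mathrm{un}}/K)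 \cong \mathrm{Gal}(\overline{k}/k)$ whose composite with the restriction map is the reduction map $\mathrm{Gal}(K^{\mathrm{sep}}/K) \to \mathrm{Gal}(\overline{k}/k)$, which sends $\sigma$ to the automorphism of $\overline{k}$ induced by $\sigma|_{\mathcal{O}_{K^{\mathrm{sep}}}}$. 3. The reduction map $\mathrm{Gal}(K^{\mathrm{sep}}/K) \to \mathrm{Gal}(\overline{k}/k)$ splits: it has a section that is a continuous group homomorphism. -/

import Mathlib

namespace CompleteDVF

open IsLocalRing Polynomial

/-! ### Integral closures of a complete Noetherian local ring are local -/

/-- A finite module over a complete Noetherian local ring is complete. -/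
theorem isAdicComplete_of_finite (R M : Type*) [CommRing R] [IsLocalRing R] [IsNoetherianRing R]
    [IsAdicComplete (maximalIdeal R) R] [AddCommGroup M] [Module R M] [Module.Finite R M] :
    IsAdicComplete (maximalIdeal R) M := by
  rw [← AdicCompletion.of_bijective_iff]
  refine ⟨AdicCompletion.of_injective _ _, ?_⟩
  intro y
  obtain ⟨t, rfl⟩ := AdicCompletion.ofTensorProduct_surjective_of_finite (maximalIdeal R) M y
  induction t with
  | zero => exact ⟨0, by simp⟩
  | add a b ha hb =>
    obtain ⟨x, hx⟩ := ha
    obtain ⟨z, hz⟩ := hb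
    exact ⟨x + z, by simp [hx, hz]⟩
  | tmul a m =>
    obtain ⟨r, rfl⟩ := (AdicCompletion.of_bijective_iff.2
      (inferInstance : IsAdicComplete (maximalIdeal R) R)).2 a
    refine ⟨r • m, ?_⟩
    rw [AdicCompletion.ofTensorProduct_tmul]
    ext n
    simp only [map_smul]
    rfl

/-- A domain that is integral over a complete Noetherian local ring is local. -/
theorem isLocalRing_of_isIntegral (R A : Type*) [CommRing R] [IsLocalRing R] [IsNoetherianRing R]
    [IsAdicComplete (maximalIdeal R) R] [CommRing A] [IsDomain A] [Algebra R A]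
    [Algebra.IsIntegral R A] : IsLocalRing A := by
  refine IsLocalRing.of_isUnit_or_isUnit_one_sub_self fun a ↦ ?_
  let B := Algebra.adjoin R {a}
  have hfin : Module.Finite R B :=
    Algebra.finite_adjoin_simple_of_isIntegral (Algebra.IsIntegral.isIntegral a)
  let b : B := ⟨a, Algebra.self_mem_adjoin_singleton R a⟩
  suffices h : IsUnit b ∨ IsUnit (1 - b) by
    exact h.imp (fun h ↦ h.map B.val) (fun h ↦ by simpa [b] using h.map B.val)
  let I : Ideal B := (maximalIdeal R).map (algebraMap R B)
  have hc : IsAdicComplete I B :=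
    (IsAdicComplete.map_algebraMap_iff (I := maximalIdeal R) (M := B)).2
      (isAdicComplete_of_finite R B)
  have hH : HenselianRing B I := inferInstance
  have hloc : IsLocalHom (Ideal.Quotient.mk I) := isLocalHom_of_le_jacobson_bot I hH.jac
  let _ : Algebra (ResidueField R) (B ⧸ I) :=
    (inferInstance : Algebra (R ⧸ maximalIdeal R) (B ⧸ (maximalIdeal R).map (algebraMap R B)))
  have : IsScalarTower R (ResidueField R) (B ⧸ I) :=
    (inferInstance : IsScalarTower R (R ⧸ maximalIdeal R)
      (B ⧸ (maximalIdeal R).map (algebraMap R B)))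
  have : Module.Finite (ResidueField R) (B ⧸ I) := Module.Finite.of_restrictScalars_finite R _ _
  have hart : IsArtinianRing (B ⧸ I) := isArtinian_of_tower (ResidueField R) inferInstance
  let q := Ideal.Quotient.mk I
  obtain ⟨n, y, hy⟩ := IsArtinian.exists_pow_succ_smul_dvd (q b) (1 : B ⧸ I)
  obtain ⟨y, rfl⟩ := Ideal.Quotient.mk_surjective y
  have hy1 : q b ^ n * (q b * q y) = q b ^ n := by
    rw [smul_eq_mul, smul_eq_mul, mul_one, Nat.succ_eq_add_one, pow_succ, mul_assoc] at hy
    exact hy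
  have hyk : ∀ k : ℕ, q b ^ n * (q b * q y) ^ k = q b ^ n := by
    intro k
    induction k with
    | zero => simp
    | succ k ih => rw [pow_succ, ← mul_assoc, ih, hy1]
  -- the idempotent attached to `b`
  let e : B := (b * y) ^ n
  have he : q e * q e = q e := by
    have : q e = q b ^ n * q y ^ n := by simp [e, mul_pow]
    have h2 : q e = (q b * q y) ^ n := by simp [e]
    calc q e * q e = (q b ^ n * q y ^ n) * (q b * q y) ^ n := by rw [← this, ← h2]
      _ = (q b ^ n * (q b * q y) ^ n) * q y ^ n := by ring
      _ = q e := by rw [hyk, this]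
  have hbe : q b ^ n * q e = q b ^ n := by
    have h2 : q e = (q b * q y) ^ n := by simp [e]
    rw [h2, hyk]
  obtain ⟨f, hf, hfe⟩ := hH.is_henselian (X ^ 2 - X : B[X])
    (by
      have : (X ^ 2 - X : B[X]) = X ^ 2 - C 1 * X := by simp
      rw [this]
      exact (monic_X_pow 2).sub_of_left (by
        rw [degree_X_pow]; exact lt_of_le_of_lt (degree_C_mul_X_le _) (by norm_num)))
    e
    (by
      rw [← Ideal.Quotient.eq_zero_iff_mem]
      have : eval e (X ^ 2 - X : B[X]) = e * e - e := by simp [pow_two]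
      rw [this, map_sub, map_mul]
      exact sub_eq_zero.2 he)
    (by
      refine IsUnit.of_mul_eq_one (Ideal.Quotient.mk I (eval e (derivative (X ^ 2 - X : B[X])))) ?_
      have : eval e (derivative (X ^ 2 - X : B[X])) = 2 * e - 1 := by
        simp [one_add_one_eq_two]
      rw [this]
      change q (2 * e - 1) * q (2 * e - 1) = 1
      rw [← map_mul]
      have h3 : (2 * e - 1) * (2 * e - 1) = 4 * (e * e) - 4 * e + 1 := by ring
      rw [h3, map_add, map_sub, map_mul, map_mul, map_mul, he]
      simp)
  have hf' : f * (f - 1) = 0 := by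
    have : f ^ 2 - f = 0 := by simpa using hf
    linear_combination this
  have hqf : q f = q e := Ideal.Quotient.eq.2 hfe
  rcases mul_eq_zero.1 hf' with h | h
  · right
    have h0 : q e = 0 := by rw [← hqf, h, map_zero]
    have hnil : IsNilpotent (q b) := ⟨n, by rw [← hbe, h0, mul_zero]⟩
    have hu : IsUnit (q (1 - b)) := by
      rw [map_sub, map_one]
      exact hnil.isUnit_one_sub
    exact hloc.map_nonunit _ hu
  · left
    have h1 : q e = 1 := by rw [← hqf, sub_eq_zero.1 h, map_one]
    rcases Nat.eq_zero_or_pos n with hn | hn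
    · subst hn
      have : q b * q y = 1 := by simpa using hy1
      exact hloc.map_nonunit _ (IsUnit.of_mul_eq_one _ this)
    · have h2 : q (b * y) ^ n = 1 := by rw [← map_pow]; exact h1
      have h3 : IsUnit (q (b * y)) := IsUnit.of_pow_eq_one h2 hn.ne'
      rw [map_mul] at h3
      exact hloc.map_nonunit _ (isUnit_of_mul_isUnit_left h3)

instance integralClosure_isLocalRing (R L : Type*) [CommRing R] [IsLocalRing R]
    [IsNoetherianRing R] [IsAdicComplete (maximalIdeal R) R] [Field L] [Algebra R L] :
    IsLocalRing (integralClosure R L) :=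
  isLocalRing_of_isIntegral R (integralClosure R L)

instance integralClosure_isLocalHom (R L : Type*) [CommRing R] [IsLocalRing R]
    [Field L] [Algebra R L] : IsLocalHom (algebraMap R (integralClosure R L)) := by
  refine ⟨fun r hr ↦ ?_⟩
  by_contra hnr
  have hker : RingHom.ker (algebraMap R (integralClosure R L)) ≤ maximalIdeal R :=
    le_maximalIdeal (RingHom.ker_ne_top _)
  obtain ⟨Q, hQ, hQm⟩ :=
    Ideal.exists_ideal_over_maximal_of_isIntegral (S := integralClosure R L) (maximalIdeal R) hker
  refine hQ.ne_top (Q.eq_top_of_isUnit_mem ?_ hr)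
  have : r ∈ Q.comap (algebraMap R (integralClosure R L)) := by
    rw [hQm]; exact hnr
  exact this

/-! ### The maximal unramified extension and the two maps on Galois groups -/

/-- For a field `L` containing the complete discrete valuation ring `R`, the residue field of the
integral closure of `R` in `L`. -/
abbrev resField (R L : Type*) [CommRing R] [IsLocalRing R] [IsNoetherianRing R]
    [IsAdicComplete (maximalIdeal R) R] [Field L] [Algebra R L] : Type _ :=
  ResidueField (integralClosure R L)

section

variable (R K Ω : Type*) [CommRing R] [IsDomain R] [IsDiscreteValuationRing R]
  [IsAdicComplete (maximalIdeal R) R] [Field K] [Algebra R K] [IsFractionRing R K]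
  [Field Ω] [Algebra K Ω] [Algebra R Ω] [IsScalarTower R K Ω]

/-- A finite subextension `L / K` of `Ω / K` is unramified if the ring of integers `O_L` (the
integral closure of `R` in `L`) is unramified over `R`. -/
def IsFiniteUnramified (L : IntermediateField K Ω) : Prop :=
  FiniteDimensional K L ∧ Algebra.FormallyUnramified R (integralClosure R L)

/-- For a separable extension, being unramified means that a uniformizer of `R` generates the
maximal ideal of `O_L`, and that the residue field extension is separable. -/
theorem isFiniteUnramified_iff [Algebra.IsSeparable K Ω] (L : IntermediateField K Ω)
    [FiniteDimensional K L] :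
    IsFiniteUnramified R K Ω L ↔
      Algebra.IsSeparable (ResidueField R) (resField R L) ∧
      (maximalIdeal R).map (algebraMap R (integralClosure R L)) =
        maximalIdeal (integralClosure R L) := by
  have : Module.Finite R (integralClosure R L) := IsIntegralClosure.finite R K L _
  rw [← Algebra.FormallyUnramified.iff_map_maximalIdeal_eq]
  exact ⟨fun h ↦ h.2, fun h ↦ ⟨inferInstance, h⟩⟩

/-- The maximal unramified extension of `K` in `Ω`: the compositum of all finite unramified
subextensions. -/
def maxUnramified : IntermediateField K Ω :=
  sSup {L | IsFiniteUnramified R K Ω L}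

variable {R K Ω} in
theorem IsFiniteUnramified.map {L : IntermediateField K Ω} (h : IsFiniteUnramified R K Ω L)
    (σ : Ω ≃ₐ[K] Ω) : IsFiniteUnramified R K Ω (L.map (σ : Ω →ₐ[K] Ω)) := by
  obtain ⟨h1, h2⟩ := h
  let e : L ≃ₐ[K] L.map (σ : Ω →ₐ[K] Ω) := L.equivMap (σ : Ω →ₐ[K] Ω)
  exact ⟨Module.Finite.equiv e.toLinearEquiv,
    Algebra.FormallyUnramified.of_equiv (e.restrictScalars R).mapIntegralClosure⟩

instance maxUnramified_normal [Normal K Ω] : Normal K (maxUnramified R K Ω) := by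
  rw [IntermediateField.normal_iff_forall_map_le']
  intro σ
  rw [IntermediateField.map_le_iff_le_comap]
  refine sSup_le fun L hL ↦ ?_
  rw [← IntermediateField.map_le_iff_le_comap]
  exact le_sSup (hL.map σ)

/-- A separable closure is a normal extension. -/
instance (priority := 100) normal_of_isSepClosure [IsSepClosure K Ω] : Normal K Ω :=
  IsSepClosure.isGalois.to_normal

/-- The restriction map `Gal(Ω/K) → Gal(K^un/K)`. -/
noncomputable def restriction [IsSepClosure K Ω] :
    Gal(Ω/K) →* Gal(maxUnramified R K Ω/K) :=
  AlgEquiv.restrictNormalHom (maxUnramified R K Ω)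

/-- The reduction map: an automorphism of `Ω / K` preserves the integral closure of `R` in `Ω`, and
so induces an automorphism of its residue field over the residue field of `R`. -/
noncomputable def reduction :
    Gal(Ω/K) →* Gal(resField R Ω/ResidueField R) where
  toFun σ := ResidueField.mapAlgEquiv' (σ.restrictScalars R).mapIntegralClosure
  map_one' := by
    ext x
    obtain ⟨x, rfl⟩ := residue_surjective x
    rfl
  map_mul' σ τ := by
    ext x
    obtain ⟨x, rfl⟩ := residue_surjective x
    rfl

end

end CompleteDVF

/-!
Write `G = Gal(Ω/K)` for `Ω` a separable closure of `K`, `F` for the residue field of `Ω` and `k`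
for that of `R`.

**Restriction and reduction are the same map.** Both `G → Gal(K^un/K)` and `G → Gal(F/k)` are
continuous and surjective, and they have the same kernel. If `σ` is trivial on `K^un`, it fixes the
residues of elements of `K^un`; these contain all elements of `F` that are separable over `k`
(`exists_mem_maxUnramified_residue_eq`), and `F` is purely inseparable over the separable closure
of `k` (`reduction_eq_one_of_fixes_maxUnramified`). Conversely, if `σ` reduces to the identity and
`L` is finite unramified, then the inclusion of `O_L` and its composite with `σ` are two lifts of
the same map modulo a maximal ideal, so they agree because `O_L` is formally unramified
(`fixes_maxUnramified_of_reduction_eq_one`). Two continuous surjections from a compact group to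
Hausdorff groups with the same kernel differ by a topological isomorphism, so it is enough to split
the reduction map. The residue field `F` is algebraically closed (`resField_isAlgClosed`), even when
`k` is not perfect: this is clear if `K` has characteristic zero, and if `K` has characteristic `p`,
then the equations `X ^ p + ϖ X = a` are separable over `Ω`, so that `F` is perfect.

**Removing the tame part.** Let `ϖ` be a uniformizer, and choose a compatible system of roots
`ρ` of `ϖ` whose orders exhaust the integers prime to `p`. The polynomial `X ^ m - ϖ` stays
irreducible over `K^un` (`minpoly_maxUnramified_root`), so by compactness every `g ∈ G` agrees on
`K^un` with an element of the closed subgroup `H₀` that fixes the whole system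
(`exists_fixes_root_sequence`). An element `σ ∈ H₀` that reduces to the identity multiplies each
`x ≠ 0` by a principal unit (`exists_apply_eq_mul`). If also `σ ^ n` fixes `y` with `n` prime to
`p`, then summing the conjugates of `y - σ y` gives `σ y = y`. So the kernel of `H₀ → Gal(F/k)` is
pro-`p` (`tendsto_pow_of_reduction_eq_one`).

**Splitting the pro-`p` part.** Let a profinite group `H₀` act continuously on an algebraically
closed field `F` of characteristic `p`, with pro-`p` kernel `N`. A minimal closed subgroup `H` with
`H N = H₀` exists by Zorn's lemma. If `H ∩ N ≠ 1`, a finite quotient of `H` gives an elementary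
abelian quotient `A` of `H ∩ N`, stable under conjugation. The projection `H ∩ N → A` extends to a
crossed homomorphism `H → A` (`exists_crossedHom_zmod`): this is the vanishing of the second
cohomology of the image of `H` in `Aut F` with coefficients in `A`, which the Artin-Schreier
sequence `0 → A → F ⊗ A → F ⊗ A → 0` reduces to the triviality of the cohomology of `F ⊗ A`, and
that follows from the existence of an element of trace one. The zeros of the crossed homomorphism form a smaller
closed subgroup with the same image, a contradiction. Hence `N` has a closed complement
(`exists_closed_complement`), and inverting the bijection from it to `Gal(F/k)` gives the section.
-/

namespace CompleteDVF

open IsLocalRing Polynomial Filter Topology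
open scoped TensorProduct

universe u

/-! ### Crossed homomorphisms and elements of trace one -/

theorem mk_mul_out {H : Type*} [Group H] (D : Subgroup H) (g : H) (τ : H ⧸ D) :
    (QuotientGroup.mk (g * τ.out) : H ⧸ D) = g • τ := by
  conv_rhs => rw [← QuotientGroup.out_eq' τ]
  rfl

/-- If `D` fixes `θ`, then `τ.out • θ` depends only on the coset `τ`, so the translates of `θ`
indexed by `H ⧸ D` are permuted by `H`. -/
theorem smul_out_smul {H F : Type*} [Group H] [MulAction H F] {D : Subgroup H} {θ : F}
    (hD : ∀ d ∈ D, d • θ = θ) (g : H) (τ : H ⧸ D) :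
    g • τ.out • θ = (g • τ).out • θ := by
  have h : ((g • τ).out)⁻¹ * (g * τ.out) ∈ D := by
    rw [← QuotientGroup.eq]
    rw [mk_mul_out, QuotientGroup.out_eq']
  have := hD _ h
  rw [mul_smul, inv_smul_eq_iff, mul_smul] at this
  exact this

section Crossed

variable {H F V : Type*} [Group H] [Field F] [MulSemiringAction H F] {D : Subgroup H}
  [Finite (H ⧸ D)] {θ : F} [AddCommGroup V] [Module F V]

/-- Let `V` be an `F`-vector space with a semilinear action of `H`, and let `θ ∈ F` be fixed by `D`
with trace one over `H ⧸ D`. Then an equivariant homomorphism `r : D → V` extends to a crossed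
homomorphism on `H`. The obstruction is a class in the second cohomology of `H ⧸ D`; averaging
against `θ` trivializes it. -/
theorem exists_crossedHom_extending [D.Normal] (act : H → V →+ V)
    (hact : ∀ (h : H) (x : F) (v : V), act h (x • v) = (h • x) • act h v)
    (hD : ∀ d ∈ D, d • θ = θ) (hθ : ∑ᶠ τ : H ⧸ D, τ.out • θ = 1)
    (r : H → V) (hr : ∀ d ∈ D, ∀ d' ∈ D, r (d * d') = r d + r d')
    (hrc : ∀ h, ∀ d ∈ D, r (h * d * h⁻¹) = act h (r d)) :
    ∃ ψ : H → V, (∀ g h, ψ (g * h) = ψ g + act g (ψ h)) ∧ ∀ d ∈ D, ψ d = r d := by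
  have := Fintype.ofFinite (H ⧸ D)
  rw [finsum_eq_sum_of_fintype] at hθ
  have hmem (h : H) (τ : H ⧸ D) : h * τ.out * ((h • τ).out)⁻¹ ∈ D := by
    rw [Subgroup.Normal.mem_comm_iff inferInstance,
      ← QuotientGroup.eq, mk_mul_out, QuotientGroup.out_eq']
  -- the average over `τ` of the values of `r` on the discrepancies between `h * τ.out` and the
  -- representative of its coset, with weights the conjugates of `θ`, which add up to `1`
  refine ⟨fun h ↦ ∑ τ : H ⧸ D, ((h • τ).out • θ) • r (h * τ.out * ((h • τ).out)⁻¹), ?_, ?_⟩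
  · intro g h
    dsimp only
    rw [← Equiv.sum_comp (MulAction.toPerm h) (fun τ : H ⧸ D ↦
      ((g • τ).out • θ) • r (g * τ.out * ((g • τ).out)⁻¹)), map_sum, ← Finset.sum_add_distrib]
    refine Finset.sum_congr rfl fun τ _ ↦ ?_
    simp only [MulAction.toPerm_apply]
    rw [hact, smul_out_smul hD, ← hrc _ _ (hmem h τ), mul_smul, ← smul_add, add_comm,
      ← hr _ (Subgroup.Normal.conj_mem inferInstance _ (hmem h τ) _) _ (hmem g (h • τ))]
    congr 2
    group
  · intro d hd
    have h (τ : H ⧸ D) : d • τ = τ := by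
      induction τ using QuotientGroup.induction_on with
      | H z =>
        rw [MulAction.Quotient.smul_mk, QuotientGroup.eq, smul_eq_mul, mul_inv_rev]
        simpa using Subgroup.Normal.conj_mem inferInstance _ (D.inv_mem hd) z⁻¹
    simp only [h, mul_inv_cancel_right, ← Finset.sum_smul, hθ, one_smul]

/-- In the situation of `exists_crossedHom_extending`, a crossed homomorphism that vanishes on `D`
is principal. -/
theorem exists_eq_sub_of_crossedHom (act : H → V →+ V)
    (hact : ∀ (h : H) (x : F) (v : V), act h (x • v) = (h • x) • act h v)
    (hD : ∀ d ∈ D, d • θ = θ) (hθ : ∑ᶠ τ : H ⧸ D, τ.out • θ = 1)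
    (δ : H → V) (hδ : ∀ g h, δ (g * h) = δ g + act g (δ h)) (hδD : ∀ d ∈ D, δ d = 0) :
    ∃ b : V, ∀ h, δ h = b - act h b := by
  have := Fintype.ofFinite (H ⧸ D)
  rw [finsum_eq_sum_of_fintype] at hθ
  refine ⟨∑ τ : H ⧸ D, (τ.out • θ) • δ τ.out, fun h ↦ ?_⟩
  have key (τ : H ⧸ D) : act h (δ τ.out) = δ (h • τ).out - δ h := by
    rw [eq_sub_iff_add_eq, add_comm, ← hδ]
    have hm : ((h • τ).out)⁻¹ * (h * τ.out) ∈ D := by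
      rw [← QuotientGroup.eq, mk_mul_out, QuotientGroup.out_eq']
    conv_lhs => rw [← mul_inv_cancel_left (h • τ).out (h * τ.out), hδ, hδD _ hm]
    simp
  have h1 := Equiv.sum_comp (MulAction.toPerm h) (fun τ : H ⧸ D ↦ (τ.out • θ) • δ τ.out)
  have h2 := Equiv.sum_comp (MulAction.toPerm h) (fun τ : H ⧸ D ↦ (τ.out • θ) • δ h)
  simp only [MulAction.toPerm_apply] at h1 h2
  rw [map_sum]
  simp only [hact, smul_out_smul hD, key, smul_sub, Finset.sum_sub_distrib]
  rw [h1, h2, ← Finset.sum_smul, hθ]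
  simp

end Crossed

/-- A conjugation action on a quotient of `B` that is killed by `p` is an `𝔽_p`-linear
representation. -/
theorem exists_zmod_representation {Γ : Type*} [Group Γ] (p : ℕ) {B : Subgroup Γ} [B.Normal]
    {A : Type*} [AddCommGroup A] (hA : ∀ x : A, p • x = 0) (q : B → A)
    (hq : Function.Surjective q) (f : Γ → A →+ A)
    (hf : ∀ g b, f g (q b) = q (MulAut.conjNormal g b)) :
    ∃ (_ : Module (ZMod p) A) (ρ : Γ →* (A →ₗ[ZMod p] A)),
      ∀ g b, q (MulAut.conjNormal g b) = ρ g (q b) := by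
  obtain ⟨hmod⟩ : Nonempty (Module (ZMod p) A) := ⟨AddCommGroup.zmodModule hA⟩
  refine ⟨hmod, ⟨⟨fun g ↦ (f g).toZModLinearMap p, ?_⟩, ?_⟩, fun g b ↦ (hf g b).symm⟩
  · ext x
    obtain ⟨x, rfl⟩ := hq x
    simp [hf]
  · intro g h
    ext x
    obtain ⟨x, rfl⟩ := hq x
    simp [hf]

/-- A finite nontrivial normal `p`-subgroup has a nontrivial elementary abelian quotient
to which the conjugation action descends. -/
theorem exists_elementary_quotient {Γ : Type u} [Group Γ] (p : ℕ) [Fact p.Prime] (B : Subgroup Γ)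
    [B.Normal] [Finite B] (hB : IsPGroup p B) (hB1 : B ≠ ⊥) :
    ∃ (A : Type u) (_ : AddCommGroup A) (_ : Module (ZMod p) A) (_ : Nontrivial A)
      (ρ : Γ →* (A →ₗ[ZMod p] A)) (r : B → A), Function.Surjective r ∧
      (∀ b b', r (b * b') = r b + r b') ∧
      ∀ g b, r (MulAut.conjNormal g b) = ρ g (r b) := by
  -- the intersection of the normal subgroups of index `p` is characteristic, and the quotient by it
  -- is abelian and killed by `p`
  let C : Subgroup B := sInf {M | M.Normal ∧ M.index = p}
  have hC (x : B) : x ∈ C ↔ ∀ M : Subgroup B, M.Normal → M.index = p → x ∈ M := by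
    simp [C, Subgroup.mem_sInf]
  have hCc (f : B ≃* B) (x : B) (hx : x ∈ C) : f x ∈ C := by
    rw [hC] at hx ⊢
    intro M hM hMp
    refine hx (M.comap f.toMonoidHom) inferInstance ?_
    rw [Subgroup.index_comap_of_surjective _ f.surjective, hMp]
  have : C.Normal := ⟨fun x hx g ↦ hCc (MulAut.conj g) x hx⟩
  have hcomm (x y : B ⧸ C) : x * y = y * x := by
    induction x using QuotientGroup.induction_on with | H x => ?_
    induction y using QuotientGroup.induction_on with | H y => ?_
    rw [← QuotientGroup.mk_mul, ← QuotientGroup.mk_mul, QuotientGroup.eq, hC]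
    intro M hM hMp
    have : IsCyclic (B ⧸ M) := isCyclic_of_prime_card (p := p) (by rw [← hMp]; rfl)
    rw [← QuotientGroup.eq, QuotientGroup.mk_mul, QuotientGroup.mk_mul]
    exact (IsCyclic.commGroup (α := B ⧸ M)).mul_comm _ _
  have hpow (x : B ⧸ C) : x ^ p = 1 := by
    induction x using QuotientGroup.induction_on with | H x => ?_
    rw [← QuotientGroup.mk_pow, QuotientGroup.eq_one_iff, hC]
    intro M hM hMp
    rw [← hMp]
    exact M.pow_index_mem x
  -- the quotient is nontrivial because a finite `p`-group has a subgroup of index `p`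
  have hCt : ∃ x, x ∉ C := by
    obtain ⟨n, hn⟩ := IsPGroup.iff_card.1 hB
    have hn0 : n ≠ 0 := by
      rintro rfl
      exact hB1 (Subgroup.card_eq_one.1 (by simpa using hn))
    obtain ⟨n, rfl⟩ := Nat.exists_eq_succ_of_ne_zero hn0
    have hp : p.Prime := Fact.out
    obtain ⟨M, hM⟩ := Sylow.exists_subgroup_card_pow_prime p (G := B) (n := n)
      (by rw [hn]; exact pow_dvd_pow _ n.le_succ)
    have hMi : M.index = p := by
      have := M.card_mul_index
      rw [hM, hn, pow_succ] at this
      exact Nat.eq_of_mul_eq_mul_left (pow_pos hp.pos n) this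
    have hMn : M.Normal := Subgroup.normal_of_index_eq_minFac_card (by
      rw [hMi, hn, Nat.pow_minFac n.succ_ne_zero, hp.minFac_eq])
    have hMt : M ≠ ⊤ := by
      rintro rfl
      rw [Subgroup.index_top] at hMi
      exact hp.one_lt.ne hMi
    obtain ⟨x, hx⟩ : ∃ x, x ∉ M := by
      by_contra! h
      exact hMt (Subgroup.eq_top_iff' M |>.2 h)
    refine ⟨x, fun h ↦ hx ((hC x).1 h M hMn hMi)⟩
  let _ : CommGroup (B ⧸ C) := { mul_comm := hcomm }
  obtain ⟨hmod, ρ, hρ⟩ := exists_zmod_representation p (B := B) (A := Additive (B ⧸ C))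
    (fun x ↦ by rw [← ofMul_toMul x, ← ofMul_pow, hpow, ofMul_one])
    (fun b ↦ Additive.ofMul (QuotientGroup.mk b)) QuotientGroup.mk_surjective
    (fun g ↦ MonoidHom.toAdditive
      (QuotientGroup.map C C (MulAut.conjNormal g).toMonoidHom fun x hx ↦ hCc _ x hx))
    (fun _ _ ↦ rfl)
  obtain ⟨x, hx⟩ := hCt
  exact ⟨Additive (B ⧸ C), inferInstance, hmod,
    ⟨Additive.ofMul (QuotientGroup.mk x), 0, fun h ↦ hx ((QuotientGroup.eq_one_iff x).1 h)⟩, ρ,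
    fun b ↦ Additive.ofMul (QuotientGroup.mk b), QuotientGroup.mk_surjective,
    fun _ _ ↦ rfl, hρ⟩

/-- If a compact group `H` acts continuously on a field `F` and `U` is an open subgroup containing
the kernel of the action, then some open normal subgroup `D ≤ U` containing the kernel has a fixed
element `θ` of trace one over `H ⧸ D`. This is the surjectivity of the trace of a finite Galois
extension, proved by the linear independence of characters. -/
theorem exists_trace_eq_one {H F : Type*} [Group H] [TopologicalSpace H] [IsTopologicalGroup H]
    [CompactSpace H] [Field F] [MulSemiringAction H F]
    (hst : ∀ x : F, IsOpen (MulAction.stabilizer H x : Set H)) (U : Subgroup H)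
    (hU : IsOpen (U : Set H)) (hNU : ∀ h : H, (∀ x : F, h • x = x) → h ∈ U) :
    ∃ (D : Subgroup H) (_ : D.Normal) (θ : F), IsOpen (D : Set H) ∧ D ≤ U ∧
      (∀ h : H, (∀ x : F, h • x = x) → h ∈ D) ∧ (∀ d ∈ D, d • θ = θ) ∧
      ∑ᶠ τ : H ⧸ D, τ.out • θ = 1 := by
  -- by compactness, finitely many elements of `F` have a common stabilizer contained in `U`
  obtain ⟨S, hS⟩ := hU.isClosed_compl.isCompact.elim_finite_subfamily_closed
    (fun x : F ↦ (MulAction.stabilizer H x : Set H))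
    (fun x ↦ Subgroup.isClosed_of_isOpen _ (hst x)) (by
      ext h
      simp only [Set.mem_inter_iff, Set.mem_compl_iff, SetLike.mem_coe, Set.mem_iInter,
        MulAction.mem_stabilizer_iff, Set.mem_empty_iff_false, iff_false, not_and]
      exact fun h1 h2 ↦ h1 (hNU h h2))
  let U₀ : Subgroup H := ⨅ x ∈ S, MulAction.stabilizer H x
  have hU₀ : IsOpen (U₀ : Set H) := by
    simp only [U₀, Subgroup.coe_iInf]
    exact isOpen_biInter_finset fun x _ ↦ hst x
  have hfin : Finite (H ⧸ U₀) := Subgroup.quotient_finite_of_isOpen _ hU₀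
  have : U₀.FiniteIndex := Subgroup.finiteIndex_of_finite_quotient
  let D := U₀.normalCore
  have hD : IsOpen (D : Set H) := Subgroup.isOpen_of_isClosed_of_finiteIndex _
    (U₀.normalCore_isClosed (Subgroup.isClosed_of_isOpen _ hU₀))
  have hmemU₀ (h : H) : h ∈ U₀ ↔ ∀ x ∈ S, h • x = x := by
    simp [U₀, Subgroup.mem_iInf]
  have hfix (d : H) (hd : d ∈ D) (x : F) (hx : x ∈ S) (g : H) : d • g • x = g • x := by
    have := (hmemU₀ _).1 (U₀.normalCore_le (Subgroup.Normal.conj_mem inferInstance d hd g⁻¹)) x hx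
    rw [inv_inv, mul_smul, mul_smul, inv_smul_eq_iff] at this
    exact this
  have hfin' : Finite (H ⧸ D) := Subgroup.quotient_finite_of_isOpen _ hD
  have := Fintype.ofFinite (H ⧸ D)
  -- the characters of the fixed field of `D` given by the elements of `H / D`
  let E : Subfield F := FixedPoints.subfield D F
  have hE (x : F) : x ∈ E ↔ ∀ d ∈ D, d • x = x :=
    ⟨fun h d hd ↦ h ⟨d, hd⟩, fun h d ↦ h d.1 d.2⟩
  let χ (τ : H ⧸ D) : E →* F :=
    ((MulSemiringAction.toRingHom H F τ.out).comp E.subtype : E →+* F)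
  have hχ : Function.Injective χ := by
    intro τ τ' h
    rw [← QuotientGroup.out_eq' τ, ← QuotientGroup.out_eq' τ', QuotientGroup.eq]
    have h1 (x : F) (hx : x ∈ E) : τ.out • x = τ'.out • x := DFunLike.congr_fun h ⟨x, hx⟩
    refine fun g ↦ (hmemU₀ _).2 fun x hx ↦ ?_
    rw [mul_smul, mul_smul, ← eq_inv_smul_iff, mul_smul, inv_smul_eq_iff]
    exact (h1 _ ((hE _).2 fun d hd ↦ hfix d hd x hx g⁻¹)).symm
  have hli := (linearIndependent_monoidHom E F).comp χ hχ
  obtain ⟨e, he⟩ : ∃ e : E, ∑ τ, χ τ e ≠ 0 := by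
    by_contra! h
    rw [Fintype.linearIndependent_iff] at hli
    refine one_ne_zero (hli (fun _ ↦ 1) ?_ (QuotientGroup.mk 1))
    ext e
    simpa using h e
  have hed := (hE _).1 e.2
  have hc (h : H) : h • ∑ τ, χ τ e = ∑ τ, χ τ e := by
    rw [Finset.smul_sum]
    refine Eq.trans ?_ (Equiv.sum_comp (MulAction.toPerm h) fun τ ↦ χ τ e)
    exact Finset.sum_congr rfl fun τ _ ↦ smul_out_smul hed h τ
  refine ⟨D, inferInstance, e / ∑ τ, χ τ e, hD, ?_, fun h hh g ↦ ?_, fun d hd ↦ ?_, ?_⟩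
  · intro d hd
    by_contra h
    have : d ∈ (U : Set H)ᶜ ∩ ⋂ x ∈ S, (MulAction.stabilizer H x : Set H) := by
      refine ⟨h, ?_⟩
      simpa using (hmemU₀ d).1 (U₀.normalCore_le hd)
    rw [hS] at this
    exact this
  · exact (hmemU₀ _).2 fun x _ ↦ by rw [mul_smul, mul_smul, hh, smul_inv_smul]
  · rw [smul_div₀', hc, hed d hd]
  · rw [finsum_eq_sum_of_fintype]
    simp only [smul_div₀', hc]
    rw [← Finset.sum_div]
    exact div_self he

/-! ### Extension of crossed homomorphisms with finite coefficients -/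

/-- Let `H` act on an algebraically closed field `F` of characteristic `p`, and let `A` be an
`𝔽_p`-representation of `H` that is trivial on `D`. If some `θ` fixed by `D` has trace one, an
equivariant homomorphism `r : D → A` extends to a crossed homomorphism `φ` on `H`, up to replacing
`D` by the stabilizer in `D` of finitely many elements of `F`. -/
theorem exists_crossedHom_zmod {H F : Type*} [Group H] [Field F] [IsAlgClosed F]
    [MulSemiringAction H F] (p : ℕ) [Fact p.Prime] [CharP F p]
    {D : Subgroup H} [D.Normal] [Finite (H ⧸ D)] {θ : F}
    (hD : ∀ d ∈ D, d • θ = θ) (hθ : ∑ᶠ τ : H ⧸ D, τ.out • θ = 1)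
    {A : Type*} [AddCommGroup A] [Module (ZMod p) A] (ρ : H →* (A →ₗ[ZMod p] A))
    (hDA : ∀ d ∈ D, ρ d = 1)
    (r : H → A) (hr : ∀ d ∈ D, ∀ d' ∈ D, r (d * d') = r d + r d')
    (hrc : ∀ h, ∀ d ∈ D, r (h * d * h⁻¹) = ρ h (r d)) :
    ∃ φ : H → A, (∀ g h, φ (g * h) = φ g + ρ g (φ h)) ∧
      ∃ S : Finset F, ∀ d ∈ D, (∀ x ∈ S, d • x = x) → φ d = r d := by
  let _ : Algebra (ZMod p) F := ZMod.algebra F p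
  have hp : p.Prime := Fact.out
  have : ExpChar F p := .prime hp
  let s (h : H) : F →ₗ[ZMod p] F :=
    (MulSemiringAction.toRingHom H F h).toAddMonoidHom.toZModLinearMap p
  have hs (h : H) (x : F) : s h x = h • x := rfl
  let act (h : H) : F ⊗[ZMod p] A →+ F ⊗[ZMod p] A :=
    (TensorProduct.map (s h) (ρ h)).toAddMonoidHom
  have hact_tmul (h : H) (x : F) (a : A) : act h (x ⊗ₜ a) = (h • x) ⊗ₜ ρ h a := rfl
  have hact_mul (g h : H) (v : F ⊗[ZMod p] A) : act (g * h) v = act g (act h v) := by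
    induction v with
    | zero => simp
    | add a b ha hb => simp only [map_add, ha, hb]
    | tmul x a => simp [hact_tmul, mul_smul]
  have hact (h : H) (x : F) (v : F ⊗[ZMod p] A) : act h (x • v) = (h • x) • act h v := by
    induction v with
    | zero => simp
    | add a b ha hb => rw [smul_add, map_add, ha, hb, map_add, smul_add]
    | tmul y a => simp [hact_tmul, TensorProduct.smul_tmul', smul_mul']
  -- the Artin-Schreier sequence, tensored with `A`
  let P : F →ₗ[ZMod p] F := ((frobenius F p).toAddMonoidHom - AddMonoidHom.id F).toZModLinearMap p
  have hP (x : F) : P x = x ^ p - x := rfl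
  have hPs : Function.Surjective P := by
    intro a
    have hdeg : (X ^ p - (X + C a) : F[X]).degree ≠ 0 := by
      rw [degree_sub_eq_left_of_degree_lt, degree_X_pow]
      · exact_mod_cast hp.ne_zero
      · rw [degree_X_pow, degree_X_add_C]
        exact_mod_cast hp.one_lt
    obtain ⟨x, hx⟩ := IsAlgClosed.exists_root _ hdeg
    refine ⟨x, ?_⟩
    rw [hP]
    have : x ^ p - (x + a) = 0 := by simpa using hx
    linear_combination this
  have hPe : Function.Exact (Algebra.linearMap (ZMod p) F) P := by
    intro x
    rw [hP, sub_eq_zero, ← Subfield.mem_bot_iff_pow_eq_self]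
    rw [Subfield.bot_eq_of_zMod_algebra p]
    rfl
  let PA := P.rTensor A
  have hPA_act (h : H) (v : F ⊗[ZMod p] A) : PA (act h v) = act h (PA v) := by
    induction v with
    | zero => simp
    | add a b ha hb => simp only [map_add, ha, hb]
    | tmul y a => simp [PA, hact_tmul, hP, smul_sub, smul_pow']
  have hPAs : Function.Surjective PA := LinearMap.rTensor_surjective A hPs
  have hPAe : Function.Exact ((Algebra.linearMap (ZMod p) F).rTensor A) PA :=
    Module.Flat.rTensor_exact A hPe
  let ι : A →ₗ[ZMod p] F ⊗[ZMod p] A :=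
    (Algebra.linearMap (ZMod p) F).rTensor A ∘ₗ (TensorProduct.lid (ZMod p) A).symm.toLinearMap
  have hιi : Function.Injective ι :=
    (Module.Flat.rTensor_preserves_injective_linearMap (M := A) (Algebra.linearMap (ZMod p) F)
      (algebraMap (ZMod p) F).injective).comp (TensorProduct.lid (ZMod p) A).symm.injective
  have hιe (v) (hv : PA v = 0) : ∃ a, ι a = v := by
    obtain ⟨w, rfl⟩ := (hPAe v).1 hv
    exact ⟨TensorProduct.lid (ZMod p) A w, by simp [ι]⟩
  have hι (a : A) : ι a = 1 ⊗ₜ a := by simp [ι]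
  have hPι (a : A) : PA (ι a) = 0 := by simp [hι, PA, hP]
  have hactι (h : H) (a : A) : act h (ι a) = ι (ρ h a) := by
    rw [hι, hι, hact_tmul, smul_one]
  -- the extension `ψ` of `r` has values in `F ⊗ A`; its image under `PA` vanishes on `D`, hence is
  -- principal, and subtracting a principal crossed homomorphism from `ψ` brings it into `A`
  obtain ⟨ψ, hψ, hψD⟩ := exists_crossedHom_extending act hact hD hθ (fun h ↦ ι (r h))
    (fun d hd d' hd' ↦ by rw [hr d hd d' hd', map_add])
    (fun h d hd ↦ by rw [hrc h d hd, hactι])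
  obtain ⟨b, hb⟩ := exists_eq_sub_of_crossedHom act hact hD hθ (fun h ↦ PA (ψ h))
    (fun g h ↦ by rw [hψ, map_add, hPA_act]) (fun d hd ↦ by rw [hψD d hd, hPι])
  obtain ⟨c, rfl⟩ := hPAs b
  choose φ hφ using fun h ↦ hιe (ψ h - (c - act h c)) (by
    rw [map_sub, map_sub, hPA_act, hb, sub_self])
  refine ⟨φ, fun g h ↦ hιi ?_, ?_⟩
  · rw [map_add, ← hactι, hφ, hφ, hφ, hψ, map_sub, map_sub, hact_mul]
    abel
  -- the correction term `c - act d c` vanishes as soon as `d` fixes the coefficients of `c`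
  · have hS : ∃ S : Finset F, ∀ d ∈ D, (∀ x ∈ S, d • x = x) → act d c = c := by
      classical
      clear hb hφ
      induction c with
      | zero => exact ⟨∅, by simp⟩
      | add a b ha hb =>
        obtain ⟨S, hS⟩ := ha
        obtain ⟨T, hT⟩ := hb
        refine ⟨S ∪ T, fun d hd h ↦ ?_⟩
        rw [map_add, hS d hd fun x hx ↦ h x (Finset.mem_union_left _ hx),
          hT d hd fun x hx ↦ h x (Finset.mem_union_right _ hx)]
      | tmul x a =>
        refine ⟨{x}, fun d hd h ↦ ?_⟩
        rw [hact_tmul, hDA d hd, h x (Finset.mem_singleton_self x)]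
        rfl
    obtain ⟨S, hS⟩ := hS
    refine ⟨S, fun d hd h ↦ hιi ?_⟩
    rw [hφ, hS d hd h, hψD d hd, sub_self, sub_zero]

/-! ### Complements of pro-`p` kernels -/

section Complement

variable {G F : Type*} [Group G] [TopologicalSpace G] [IsTopologicalGroup G] [CompactSpace G]
  [TotallyDisconnectedSpace G] [Field F] [IsAlgClosed F] [MulSemiringAction G F]

/-- Let a profinite group `G` act continuously on an algebraically closed field of characteristic
`p`, with pro-`p` kernel. If the kernel is nontrivial, some proper closed subgroup of `G` has the
same image as `G` in the automorphisms of the field. -/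
theorem exists_closed_proper_supplement (p : ℕ) [Fact p.Prime] [CharP F p]
    (hst : ∀ x : F, IsOpen (MulAction.stabilizer G x : Set G))
    (hpro : ∀ σ : G, (∀ x : F, σ • x = x) → Tendsto (fun k : ℕ ↦ σ ^ p ^ k) atTop (𝓝 1))
    {σ₀ : G} (hσ₀ : ∀ x : F, σ₀ • x = x) (hσ₀1 : σ₀ ≠ 1) :
    ∃ H : Subgroup G, IsClosed (H : Set G) ∧ H ≠ ⊤ ∧ ∀ g : G, ∃ h ∈ H, ∀ x : F, h • x = g • x := by
  let N : Subgroup G := (MulAction.toPermHom G F).ker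
  have hN (g : G) : g ∈ N ↔ ∀ x : F, g • x = x := by
    simp [N, MonoidHom.mem_ker, Equiv.ext_iff]
  -- a finite quotient of `G` in which `σ₀` survives
  obtain ⟨W, hW⟩ := ProfiniteGrp.exist_openNormalSubgroup_sub_open_nhds_of_one
    (isOpen_compl_singleton (x := σ₀)) (by simpa using hσ₀1.symm)
  have hWo : IsOpen (W.toSubgroup : Set G) := W.isOpen'
  let q : G →* G ⧸ W.toSubgroup := QuotientGroup.mk' _
  have hq1 (g : G) : q g = 1 ↔ g ∈ W.toSubgroup := QuotientGroup.eq_one_iff g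
  have : Finite (G ⧸ W.toSubgroup) := Subgroup.quotient_finite_of_isOpen _ hWo
  let B := N.map q
  have : B.Normal := Subgroup.Normal.map inferInstance q (QuotientGroup.mk'_surjective _)
  have hBp : IsPGroup p B := by
    rintro ⟨_, σ, hσ, rfl⟩
    obtain ⟨k, hk⟩ := ((hpro σ ((hN σ).1 hσ)).eventually (hWo.mem_nhds (one_mem _))).exists
    refine ⟨k, Subtype.ext ?_⟩
    rw [Subgroup.coe_pow, ← map_pow]
    exact (hq1 _).2 hk
  have hB1 : B ≠ ⊥ := by
    intro h
    have : q σ₀ ∈ B := ⟨σ₀, (hN _).2 hσ₀, rfl⟩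
    rw [h, Subgroup.mem_bot, hq1] at this
    exact hW this rfl
  obtain ⟨A, _, _, _, ρ, r, hrs, hr, hrc⟩ := exists_elementary_quotient p B hBp hB1
  -- `B` acts trivially on its abelian quotient
  have hBρ (b : G ⧸ W.toSubgroup) (hb : b ∈ B) : ρ b = 1 := by
    ext a
    obtain ⟨b', rfl⟩ := hrs a
    have h1 : MulAut.conjNormal b b' = ⟨b, hb⟩ * b' * (⟨b, hb⟩ : B)⁻¹ := Subtype.ext (by simp)
    have h2 := hr (MulAut.conjNormal b b') ⟨b, hb⟩
    rw [← hrc]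
    conv_lhs at h2 => rw [h1, inv_mul_cancel_right, hr, add_comm]
    exact (add_right_cancel h2).symm
  obtain ⟨D, _, θ, hDo, hDU, hDN, hDθ, hθ⟩ := exists_trace_eq_one hst (B.comap q)
    (Subgroup.isOpen_mono (H₁ := W.toSubgroup) (fun w hw ↦ by
      rw [Subgroup.mem_comap, (hq1 w).2 hw]; exact one_mem _) hWo)
    (fun σ hσ ↦ ⟨σ, (hN σ).2 hσ, rfl⟩)
  have hND (n : G) (hn : n ∈ N) : n ∈ D := hDN n ((hN n).1 hn)
  have : Finite (G ⧸ D) := Subgroup.quotient_finite_of_isOpen _ hDo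
  classical
  -- `r'` is `r` on the preimage of `B`, extended by a value that is never used
  let r' (g : G) : A := if h : q g ∈ B then r ⟨q g, h⟩ else 0
  have hr' (g : G) (h : q g ∈ B) : r' g = r ⟨q g, h⟩ := dif_pos h
  obtain ⟨φ, hφ, S, hS⟩ := exists_crossedHom_zmod p hDθ hθ (ρ.comp q)
    (fun d hd ↦ hBρ _ (hDU hd)) r'
    (fun d hd d' hd' ↦ by
      rw [hr' d (hDU hd), hr' d' (hDU hd'), hr' _ (hDU (mul_mem hd hd')), ← hr]
      exact congrArg r (Subtype.ext (map_mul q d d')))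
    (fun h d hd ↦ by
      rw [hr' d (hDU hd), hr' _ (hDU (Subgroup.Normal.conj_mem inferInstance d hd h)),
        MonoidHom.comp_apply, ← hrc]
      exact congrArg r (Subtype.ext (by simp)))
  have hφN (n : G) (hn : n ∈ N) : φ n = r ⟨q n, Subgroup.mem_map_of_mem q hn⟩ := by
    rw [hS n (hND n hn) fun x _ ↦ (hN n).1 hn x, hr' n (Subgroup.mem_map_of_mem q hn)]
  have hφ1 : φ 1 = 0 := by simpa using hφ 1 1
  -- the zeros of `φ` form an open subgroup; it is proper because `φ` is nonzero on `N`, and it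
  -- meets every coset of `N` because `φ` maps `N` onto `A`
  let H : Subgroup G :=
    { carrier := {g | φ g = 0}
      one_mem' := hφ1
      mul_mem' := fun {a b} (ha : φ a = 0) (hb : φ b = 0) ↦ show φ (a * b) = 0 by
        rw [hφ, ha, hb, map_zero, add_zero]
      inv_mem' := fun {a} (ha : φ a = 0) ↦ show φ a⁻¹ = 0 by
        have := hφ a⁻¹ a
        rw [inv_mul_cancel, hφ1, ha, map_zero, add_zero] at this
        exact this.symm }
  have hH (g : G) : g ∈ H ↔ φ g = 0 := Iff.rfl
  have hr1 : r 1 = 0 := by simpa using hr 1 1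
  have hHo : IsOpen (H : Set G) := by
    have hV : IsOpen
        ((W.toSubgroup ⊓ D ⊓ ⨅ x ∈ S, MulAction.stabilizer G x : Subgroup G) : Set G) := by
      simp only [Subgroup.coe_inf, Subgroup.coe_iInf]
      exact (hWo.inter hDo).inter (isOpen_biInter_finset fun x _ ↦ hst x)
    refine Subgroup.isOpen_mono (fun g hg ↦ ?_) hV
    obtain ⟨⟨h1, h2⟩, h3⟩ := hg
    have hq : q g = 1 := (hq1 g).2 h1
    rw [hH, hS g h2 (by simpa [Subgroup.mem_iInf] using h3), hr' g (by rw [hq]; exact one_mem B),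
      ← hr1]
    congr 1
    exact Subtype.ext hq
  refine ⟨H, Subgroup.isClosed_of_isOpen _ hHo, ?_, fun g ↦ ?_⟩
  · obtain ⟨a, ha⟩ := exists_ne (0 : A)
    obtain ⟨⟨_, n, hn, rfl⟩, rfl⟩ := hrs a
    intro h
    have : n ∈ H := h ▸ Subgroup.mem_top n
    rw [hH, hφN n hn] at this
    exact ha this
  · obtain ⟨⟨_, n, hn, rfl⟩, h⟩ := hrs (-(ρ (q g)⁻¹ (φ g)))
    refine ⟨g * n, ?_, fun x ↦ by rw [mul_smul, (hN n).1 hn]⟩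
    rw [hH, hφ, hφN n hn, h, map_neg, MonoidHom.comp_apply, ← Module.End.mul_apply, ← map_mul]
    simp

/-- A profinite group `G` acting continuously on an algebraically closed field of characteristic
`p` by field automorphisms, such that the kernel is pro-`p`: then the kernel has a closed
complement. It is a minimal closed subgroup with the same image as `G`. -/
theorem exists_closed_complement (p : ℕ) [Fact p.Prime] [CharP F p]
    (hst : ∀ x : F, IsOpen (MulAction.stabilizer G x : Set G))
    (hpro : ∀ σ : G, (∀ x : F, σ • x = x) → Tendsto (fun k : ℕ ↦ σ ^ p ^ k) atTop (𝓝 1)) :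
    ∃ H : Subgroup G, IsClosed (H : Set G) ∧ (∀ g : G, ∃ h ∈ H, ∀ x : F, h • x = g • x) ∧
      ∀ h ∈ H, (∀ x : F, h • x = x) → h = 1 := by
  let T : Set (Subgroup G) :=
    {H | IsClosed (H : Set G) ∧ ∀ g : G, ∃ h ∈ H, ∀ x : F, h • x = g • x}
  have hcoset (g : G) : IsClosed {h : G | ∀ x : F, h • x = g • x} := by
    have : {h : G | ∀ x : F, h • x = g • x} =
        ⋂ x : F, (fun h ↦ g⁻¹ * h) ⁻¹' (MulAction.stabilizer G x : Set G) := by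
      ext h
      simp [mul_smul, inv_smul_eq_iff]
    rw [this]
    exact isClosed_iInter fun x ↦
      (Subgroup.isClosed_of_isOpen _ (hst x)).preimage (continuous_const_mul g⁻¹)
  obtain ⟨H, hH⟩ : ∃ H, Minimal (· ∈ T) H := by
    -- an intersection of a chain still meets every coset of the kernel, by compactness
    have hchain (c : Set (Subgroup G)) (hc : c ⊆ T) (hch : IsChain (· ≤ ·) c) (hne : c.Nonempty) :
        sInf c ∈ T := by
      refine ⟨?_, fun g ↦ ?_⟩
      · rw [Subgroup.coe_sInf]
        exact isClosed_biInter fun H hH ↦ (hc hH).1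
      · have : Nonempty c := hne.to_subtype
        have hcl (H : c) : IsClosed ((H.1 : Set G) ∩ {h : G | ∀ x : F, h • x = g • x}) :=
          (hc H.2).1.inter (hcoset g)
        obtain ⟨h, hh⟩ := IsCompact.nonempty_iInter_of_directed_nonempty_isCompact_isClosed
          (fun H : c ↦ (H.1 : Set G) ∩ {h : G | ∀ x : F, h • x = g • x})
          (fun H₁ H₂ ↦ by
            rcases hch.total H₁.2 H₂.2 with h | h
            · exact ⟨H₁, subset_rfl, Set.inter_subset_inter_left _ h⟩
            · exact ⟨H₂, Set.inter_subset_inter_left _ h, subset_rfl⟩)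
          (fun H ↦ (hc H.2).2 g) (fun H ↦ (hcl H).isCompact) hcl
        rw [Set.mem_iInter] at hh
        exact ⟨h, Subgroup.mem_sInf.2 fun H hH ↦ (hh ⟨H, hH⟩).1, (hh (Classical.arbitrary c)).2⟩
    obtain ⟨H, -, hH⟩ := @zorn_le_nonempty₀ (Subgroup G)ᵒᵈ _ T
      (fun c hc hch y hy ↦
        ⟨_, hchain c hc hch.symm ⟨y, hy⟩, fun z hz ↦ sInf_le (α := Subgroup G) hz⟩)
      (OrderDual.toDual ⊤) ⟨isClosed_univ, fun g ↦ ⟨g, Subgroup.mem_top g, fun _ ↦ rfl⟩⟩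
    exact ⟨H, hH⟩
  refine ⟨H, hH.prop.1, hH.prop.2, fun σ hσ hσF ↦ ?_⟩
  by_contra hσ1
  have : CompactSpace H := isCompact_iff_compactSpace.1 hH.prop.1.isCompact
  obtain ⟨H', hH'c, hH't, hH's⟩ := exists_closed_proper_supplement (G := H) (F := F) p
    (fun x ↦ (hst x).preimage continuous_subtype_val)
    (fun τ hτ ↦ by
      rw [tendsto_subtype_rng]
      exact hpro τ hτ) (σ₀ := ⟨σ, hσ⟩) hσF (fun h ↦ hσ1 congr(($h : G)))
  have hmem : H'.map H.subtype ∈ T := by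
    refine ⟨?_, fun g ↦ ?_⟩
    · rw [Subgroup.coe_map]
      exact hH.prop.1.isClosedEmbedding_subtypeVal.isClosedMap _ hH'c
    · obtain ⟨h, hh, hhg⟩ := hH.prop.2 g
      obtain ⟨h', hh', hhg'⟩ := hH's ⟨h, hh⟩
      exact ⟨h', ⟨h', hh', rfl⟩, fun x ↦ (hhg' x).trans (hhg x)⟩
  have hle := hH.le_of_le hmem (Subgroup.map_subtype_le H')
  refine hH't (eq_top_iff.2 fun x _ ↦ ?_)
  obtain ⟨y, hy, hyx⟩ := hle x.2
  rwa [← Subtype.ext hyx]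

end Complement

/-! ### Valuations of elements of finite extensions -/

section Valuation

/-- In a discrete valuation ring `S` with fraction field `L`, a nonzero element `ϖ` of the maximal
ideal has some valuation `e ≥ 1`, and then every `x ≠ 0` in `L` has `x ^ e = u ϖ ^ k` for a unit
`u`. -/
theorem exists_pow_eq_unit_mul_zpow (S L : Type*) [CommRing S] [IsDomain S]
    [IsDiscreteValuationRing S] [Field L] [Algebra S L] [IsFractionRing S L] {ϖ : S}
    (h0 : ϖ ≠ 0) (h1 : ¬ IsUnit ϖ) :
    ∃ e : ℕ, e ≠ 0 ∧ (Irreducible ϖ → e = 1) ∧ ∀ x : L, x ≠ 0 → ∃ (u : Sˣ) (k : ℤ),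
      x ^ e = algebraMap S L u * algebraMap S L ϖ ^ k := by
  obtain ⟨π, hπ⟩ : ∃ π : S, Irreducible π ∧ (Irreducible ϖ → π = ϖ) := by
    by_cases h : Irreducible ϖ
    · exact ⟨ϖ, h, fun _ ↦ rfl⟩
    · obtain ⟨π, hπ⟩ := IsDiscreteValuationRing.exists_irreducible S
      exact ⟨π, hπ, fun h' ↦ absurd h' h⟩
  obtain ⟨hπ, hπϖ⟩ := hπ
  obtain ⟨e, w, hw⟩ := IsDiscreteValuationRing.eq_unit_mul_pow_irreducible h0 hπ
  have hinj := IsFractionRing.injective S L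
  have hπ0 : algebraMap S L π ≠ 0 := by
    rw [Ne, map_eq_zero_iff _ hinj]; exact hπ.ne_zero
  have hint (a : S) (ha : a ≠ 0) : ∃ (u : Sˣ) (k : ℤ),
      algebraMap S L a ^ e = algebraMap S L u * algebraMap S L ϖ ^ k := by
    obtain ⟨j, v, rfl⟩ := IsDiscreteValuationRing.eq_unit_mul_pow_irreducible ha hπ
    refine ⟨v ^ e * (w⁻¹) ^ j, j, ?_⟩
    rw [← map_pow, zpow_natCast, ← map_pow, ← map_mul, hw]
    congr 1
    have : ((w⁻¹ : Sˣ) : S) ^ j * (w : S) ^ j = 1 := by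
      rw [← mul_pow, Units.inv_mul, one_pow]
    push_cast
    linear_combination (-1 : S) * (v : S) ^ e * (π ^ e) ^ j * this
  refine ⟨e, ?_, ?_, ?_⟩
  · rintro rfl
    rw [pow_zero, mul_one] at hw
    exact h1 (hw ▸ w.isUnit)
  -- for irreducible `ϖ` the uniformizer `π` was chosen to be `ϖ`, and `ϖ = w ϖ ^ e` forces `e = 1`
  · intro h
    obtain rfl := hπϖ h
    by_contra he
    rcases Nat.lt_or_gt_of_ne he with he | he
    · obtain rfl : e = 0 := by omega
      exact h1 (hw ▸ by simp)
    · have h2 : 1 * (1 : S) = π * (w * π ^ (e - 2)) := by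
        refine mul_left_cancel₀ h0 ?_
        have : π ^ e = π * (π * π ^ (e - 2)) := by
          rw [← pow_succ', ← pow_succ']
          congr 1
          omega
        rw [mul_one, mul_one]
        conv_lhs => rw [hw, this]
        ring
      exact h1 (IsUnit.of_mul_eq_one _ (by rw [← h2, one_mul]))
  · intro x hx
    obtain ⟨a, b, hb, rfl⟩ := IsFractionRing.div_surjective (A := S) x
    have hb0 : b ≠ 0 := nonZeroDivisors.ne_zero hb
    have ha0 : a ≠ 0 := by
      rintro rfl
      simp at hx
    obtain ⟨u, k, hu⟩ := hint a ha0
    obtain ⟨v, l, hv⟩ := hint b hb0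
    have hϖ0 : algebraMap S L ϖ ≠ 0 := by rwa [Ne, map_eq_zero_iff _ hinj]
    have hv0 : algebraMap S L v ≠ 0 := (v.isUnit.map _).ne_zero
    refine ⟨u * v⁻¹, k - l, ?_⟩
    have : algebraMap S L (v⁻¹ : Sˣ) = (algebraMap S L v)⁻¹ :=
      eq_inv_of_mul_eq_one_left (by rw [← map_mul, Units.inv_mul, map_one])
    rw [div_pow, hu, hv, zpow_sub₀ hϖ0, Units.val_mul, map_mul, this]
    field_simp

variable {R K Ω : Type*} [CommRing R] [IsDomain R] [IsDiscreteValuationRing R]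
  [IsAdicComplete (maximalIdeal R) R] [Field K] [Algebra R K] [IsFractionRing R K]
  [Field Ω] [Algebra K Ω] [Algebra R Ω] [IsScalarTower R K Ω]

theorem algebraMap_injective_of_tower (R K Ω : Type*) [CommRing R] [Field K] [Algebra R K]
    [IsFractionRing R K] [Field Ω] [Algebra K Ω] [Algebra R Ω] [IsScalarTower R K Ω] :
    Function.Injective (algebraMap R Ω) := by
  rw [IsScalarTower.algebraMap_eq R K Ω]
  exact (algebraMap K Ω).injective.comp (IsFractionRing.injective R K)

/-- If `L / K` is a finite extension with ramification index `e`, then every `x ≠ 0` in `L` has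
`x ^ e = u ϖ ^ k` for a unit `u` of the integral closure and an integer `k`, and `e = 1` when `L` is
unramified. -/
theorem exists_pow_eq_unit_mul_zpow_of_finiteDimensional [Algebra.IsSeparable K Ω] {ϖ : R}
    (hϖ : Irreducible ϖ) (L : IntermediateField K Ω) [FiniteDimensional K L] :
    ∃ e : ℕ, e ≠ 0 ∧ (IsFiniteUnramified R K Ω L → e = 1) ∧ ∀ x ∈ L, x ≠ 0 →
      ∃ (u : (integralClosure R Ω)ˣ) (k : ℤ),
        x ^ e = u * algebraMap R Ω ϖ ^ k := by
  let S := integralClosure R L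
  have hDed : IsDedekindDomain S := integralClosure.isDedekindDomain R K L
  have : IsFractionRing S L := integralClosure.isFractionRing_of_finite_extension K L
  have : IsNoetherianRing S := inferInstance
  have hinjL : Function.Injective (algebraMap R L) := algebraMap_injective_of_tower R K L
  have hinj : Function.Injective (algebraMap R S) := fun a b h ↦
    hinjL (congrArg (algebraMap S L) h)
  have h0 : algebraMap R S ϖ ≠ 0 := by
    rw [Ne, map_eq_zero_iff _ hinj]; exact hϖ.ne_zero
  have h1 : ¬ IsUnit (algebraMap R S ϖ) := fun h ↦ hϖ.not_isUnit (isUnit_of_map_unit _ _ h)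
  have hnf : ¬ IsField S := fun h ↦ h1 (by
    obtain ⟨b, hb⟩ := h.mul_inv_cancel h0
    exact IsUnit.of_mul_eq_one _ hb)
  have hS : IsDiscreteValuationRing S := ((IsDiscreteValuationRing.TFAE S hnf).out 0 2).2 hDed
  obtain ⟨e, he0, he1, he⟩ := exists_pow_eq_unit_mul_zpow S L h0 h1
  refine ⟨e, he0, fun h ↦ he1 ?_, fun x hxL hx ↦ ?_⟩
  · have := ((isFiniteUnramified_iff R K Ω L).1 h).2
    rw [hϖ.maximalIdeal_eq, Ideal.map_span, Set.image_singleton] at this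
    exact (IsDiscreteValuationRing.irreducible_iff_uniformizer _).2 this.symm
  · obtain ⟨u, k, hu⟩ := he ⟨x, hxL⟩ (fun h ↦ hx (congrArg Subtype.val h))
    refine ⟨Units.map
      ((L.val.restrictScalars R).mapIntegralClosure : S →* integralClosure R Ω) u, k, ?_⟩
    have := congrArg L.val hu
    rw [map_pow, map_mul, map_zpow₀] at this
    exact this

variable (R K) in
theorem isIntegral_or_isIntegral_inv [Algebra.IsSeparable K Ω] (x : Ω) :
    IsIntegral R x ∨ IsIntegral R x⁻¹ := by
  rcases eq_or_ne x 0 with rfl | hx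
  · exact Or.inl isIntegral_zero
  obtain ⟨ϖ, hϖ⟩ := IsDiscreteValuationRing.exists_irreducible R
  have hfin : FiniteDimensional K (IntermediateField.adjoin K {x}) :=
    IntermediateField.adjoin.finiteDimensional (Algebra.IsIntegral.isIntegral x)
  obtain ⟨e, he, -, h⟩ := exists_pow_eq_unit_mul_zpow_of_finiteDimensional hϖ
    (IntermediateField.adjoin K {x})
  obtain ⟨u, k, hu⟩ := h x (IntermediateField.mem_adjoin_simple_self K x) hx
  obtain ⟨n, rfl | rfl⟩ := k.eq_nat_or_neg
  · refine Or.inl (IsIntegral.of_pow (Nat.pos_of_ne_zero he) ?_)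
    rw [hu, zpow_natCast]
    exact IsIntegral.mul u.1.2 (isIntegral_algebraMap.pow n)
  · refine Or.inr (IsIntegral.of_pow (Nat.pos_of_ne_zero he) ?_)
    rw [inv_pow, hu, mul_inv, ← zpow_neg, neg_neg, zpow_natCast]
    have : (u.1 : Ω)⁻¹ = (u⁻¹).1 :=
      (eq_inv_of_mul_eq_one_left (congrArg Subtype.val u.inv_mul)).symm
    rw [this]
    exact IsIntegral.mul (u⁻¹).1.2 (isIntegral_algebraMap.pow n)

end Valuation

/-! ### Unramified extensions -/

section Unramified

/-- The compositum of two finite unramified algebras inside a third one is a quotient of their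
tensor product, so it is finite and unramified. -/
theorem formallyUnramified_range_productMap {R A B C : Type*} [CommRing R] [CommRing A] [CommRing B]
    [CommRing C] [Algebra R A] [Algebra R B] [Algebra R C] [Algebra.FormallyUnramified R A]
    [Algebra.FormallyUnramified R B] [Module.Finite R A] [Module.Finite R B]
    (f : A →ₐ[R] C) (g : B →ₐ[R] C) :
    Algebra.FormallyUnramified R (Algebra.TensorProduct.productMap f g).range ∧
      Module.Finite R (Algebra.TensorProduct.productMap f g).range := by
  have : Algebra.FormallyUnramified R (A ⊗[R] B) := .comp R A _
  have hs := (Algebra.TensorProduct.productMap f g).rangeRestrict_surjective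
  exact ⟨.of_surjective _ hs, Module.Finite.of_surjective
    (Algebra.TensorProduct.productMap f g).rangeRestrict.toLinearMap hs⟩

variable {R K Ω : Type*} [CommRing R] [IsDomain R] [IsDiscreteValuationRing R]
  [IsAdicComplete (maximalIdeal R) R] [Field K] [Algebra R K] [IsFractionRing R K]
  [Field Ω] [Algebra K Ω] [Algebra R Ω] [IsScalarTower R K Ω]

/-- A finite unramified subalgebra of a field over a complete discrete valuation ring is a local
ring whose maximal ideal is generated by a uniformizer, hence is integrally closed. -/
theorem isIntegrallyClosed_of_formallyUnramified [FaithfulSMul R Ω] (B : Subalgebra R Ω)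
    [Module.Finite R B] [Algebra.FormallyUnramified R B] : IsIntegrallyClosed B := by
  have : IsLocalRing B := isLocalRing_of_isIntegral R B
  have hinj : Function.Injective (algebraMap R B) := fun a b h ↦
    FaithfulSMul.algebraMap_injective R Ω (congrArg Subtype.val h)
  have : FaithfulSMul R B := (faithfulSMul_iff_algebraMap_injective R B).2 hinj
  have : IsNoetherianRing B := IsNoetherianRing.of_finite R B
  have h := ((Algebra.FormallyUnramified.iff_map_maximalIdeal_eq (R := R) (S := B)).1 ‹_›).2
  obtain ⟨ϖ, hϖ⟩ := IsDiscreteValuationRing.exists_irreducible R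
  rw [hϖ.maximalIdeal_eq, Ideal.map_span, Set.image_singleton] at h
  exact (((tfae_of_isNoetherianRing_of_isLocalRing_of_isDomain B).out 4 3 rfl rfl).1
    ⟨_, h.symm⟩).1

/-- The fraction field of a finite unramified `R`-subalgebra of `Ω` is an unramified
extension of `K`. -/
theorem exists_isFiniteUnramified_of_subalgebra (B : Subalgebra R Ω) [Module.Finite R B]
    [Algebra.FormallyUnramified R B] :
    ∃ L : IntermediateField K Ω, IsFiniteUnramified R K Ω L ∧ ∀ x ∈ B, x ∈ L := by
  have : FaithfulSMul R Ω :=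
    (faithfulSMul_iff_algebraMap_injective R Ω).2 (algebraMap_injective_of_tower R K Ω)
  have := isIntegrallyClosed_of_formallyUnramified B
  obtain ⟨s, hs⟩ := Module.Finite.fg_top (R := R) (M := B)
  let L : IntermediateField K Ω := IntermediateField.adjoin K (Subtype.val '' (s : Set B))
  have hLfin : FiniteDimensional K L := by
    have : Finite (Subtype.val '' (s : Set B)) := (s.finite_toSet.image _).to_subtype
    refine IntermediateField.finiteDimensional_adjoin ?_
    rintro _ ⟨b, -, rfl⟩
    exact ((Algebra.IsIntegral.isIntegral (R := R) b).map B.val).tower_top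
  have hBL (x : Ω) (hx : x ∈ B) : x ∈ L := by
    have : (⟨x, hx⟩ : B) ∈ Submodule.span R (s : Set B) := hs ▸ Submodule.mem_top
    have h2 : Submodule.span R (s : Set B) ≤
        ((L.toSubalgebra.restrictScalars R).comap B.val).toSubmodule := by
      rw [Submodule.span_le]
      exact fun b hb ↦ IntermediateField.subset_adjoin K _ ⟨b, hb, rfl⟩
    exact h2 this
  -- every element of `L` is a fraction of elements of `B`
  let j : FractionRing B →+* Ω := IsFractionRing.lift (g := algebraMap B Ω) Subtype.val_injective
  have hj (b : B) : j (algebraMap B _ b) = b := IsFractionRing.lift_algebraMap _ b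
  have hK (x : K) : algebraMap K Ω x ∈ j.fieldRange := by
    obtain ⟨a, b, -, rfl⟩ := IsFractionRing.div_surjective (A := R) x
    rw [map_div₀, ← IsScalarTower.algebraMap_apply, ← IsScalarTower.algebraMap_apply]
    exact div_mem ⟨_, hj (algebraMap R B a)⟩ ⟨_, hj (algebraMap R B b)⟩
  have hLj (x : Ω) (hx : x ∈ L) : x ∈ j.fieldRange := by
    have : L ≤ j.fieldRange.toIntermediateField hK := by
      rw [IntermediateField.adjoin_le_iff]
      rintro _ ⟨b, -, rfl⟩
      exact ⟨_, hj b⟩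
    exact this hx
  -- as `B` is integrally closed, it is the ring of integers of `L`
  have hint (x : Ω) (hxL : x ∈ L) (hx : IsIntegral R x) : x ∈ B := by
    obtain ⟨y, rfl⟩ := hLj x hxL
    have h1 : IsIntegral B y := by
      let j' : FractionRing B →ₐ[R] Ω :=
        { j with
          commutes' r := by
            rw [IsScalarTower.algebraMap_apply R B (FractionRing B)]
            exact hj _ }
      exact ((isIntegral_algHom_iff j' j.injective).1 hx).tower_top
    obtain ⟨b, rfl⟩ := IsIntegrallyClosed.isIntegral_iff.1 h1
    rw [hj]
    exact b.2
  let f : integralClosure R L →ₐ[R] Ω := (L.val.restrictScalars R).comp (integralClosure R L).val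
  have hf : Function.Injective f := fun x y h ↦ Subtype.ext (Subtype.ext h)
  have hrange : f.range = B := by
    ext x
    constructor
    · rintro ⟨y, rfl⟩
      exact hint _ y.1.2 (y.2.map (L.val.restrictScalars R))
    · intro hx
      refine ⟨⟨⟨x, hBL x hx⟩, ?_⟩, rfl⟩
      refine (isIntegral_algHom_iff (L.val.restrictScalars R) L.val.injective).1 ?_
      exact (Algebra.IsIntegral.isIntegral (R := R) (⟨x, hx⟩ : B)).map B.val
  exact ⟨L, ⟨hLfin, Algebra.FormallyUnramified.of_equiv
    ((AlgEquiv.ofInjective f hf).trans (Subalgebra.equivOfEq _ _ hrange)).symm⟩, hBL⟩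

/-- The compositum of two finite unramified extensions is contained in a finite unramified
extension. -/
theorem IsFiniteUnramified.exists_sup_le [Algebra.IsSeparable K Ω] {L₁ L₂ : IntermediateField K Ω}
    (h₁ : IsFiniteUnramified R K Ω L₁) (h₂ : IsFiniteUnramified R K Ω L₂) :
    ∃ L : IntermediateField K Ω, IsFiniteUnramified R K Ω L ∧ L₁ ≤ L ∧ L₂ ≤ L := by
  obtain ⟨hf₁, hu₁⟩ := h₁
  obtain ⟨hf₂, hu₂⟩ := h₂
  have : Module.Finite R (integralClosure R L₁) := IsIntegralClosure.finite R K L₁ _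
  have : Module.Finite R (integralClosure R L₂) := IsIntegralClosure.finite R K L₂ _
  let f₁ := (L₁.val.restrictScalars R).comp (integralClosure R L₁).val
  let f₂ := (L₂.val.restrictScalars R).comp (integralClosure R L₂).val
  obtain ⟨_, _⟩ := formallyUnramified_range_productMap f₁ f₂
  obtain ⟨L, hL, hfL⟩ :=
    exists_isFiniteUnramified_of_subalgebra (K := K) (Algebra.TensorProduct.productMap f₁ f₂).range
  -- a field is generated over `K` by its integers
  have key (M : IntermediateField K Ω)
      (hM : ∀ y : integralClosure R M, (y : Ω) ∈ L) : M ≤ L := by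
    intro x hx
    have halg : IsAlgebraic R (⟨x, hx⟩ : M) :=
      (IsFractionRing.isAlgebraic_iff R K M).2
        (Algebra.IsAlgebraic.isAlgebraic (R := K) (⟨x, hx⟩ : M))
    obtain ⟨a, ha, hax⟩ := halg.exists_integral_multiple
    rw [Algebra.smul_def] at hax
    have h1 : algebraMap R Ω a * x ∈ L := hM ⟨_, hax⟩
    have h2 : algebraMap R Ω a ∈ L := by
      rw [IsScalarTower.algebraMap_apply R K Ω]
      exact L.algebraMap_mem _
    have h3 : algebraMap R Ω a ≠ 0 := by
      rwa [Ne, map_eq_zero_iff _ (algebraMap_injective_of_tower R K Ω)]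
    rw [← inv_mul_cancel_left₀ h3 x]
    exact mul_mem (inv_mem h2) h1
  refine ⟨L, hL, key L₁ fun y ↦ hfL _ ⟨y ⊗ₜ 1, ?_⟩, key L₂ fun y ↦ hfL _ ⟨1 ⊗ₜ y, ?_⟩⟩
  · simp [f₁]
  · simp [f₂]

/-- The finite unramified extensions are directed, so their compositum is their union. -/
theorem mem_maxUnramified_iff [Algebra.IsSeparable K Ω] (x : Ω) :
    x ∈ maxUnramified R K Ω ↔ ∃ L, IsFiniteUnramified R K Ω L ∧ x ∈ L := by
  refine ⟨fun h ↦ ?_, fun ⟨L, hL, hx⟩ ↦ le_sSup (a := L) hL hx⟩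
  -- the family is nonempty: the subalgebra `R` itself is unramified
  have hne : {L | IsFiniteUnramified R K Ω L}.Nonempty := by
    have hs : Function.Surjective (Algebra.ofId R (⊥ : Subalgebra R Ω)) := fun x ↦ by
      obtain ⟨r, hr⟩ := Algebra.mem_bot.1 x.2
      exact ⟨r, Subtype.ext hr⟩
    have : Algebra.FormallyUnramified R (⊥ : Subalgebra R Ω) := .of_surjective _ hs
    have : Module.Finite R (⊥ : Subalgebra R Ω) := Module.Finite.of_surjective
      (Algebra.ofId R (⊥ : Subalgebra R Ω)).toLinearMap hs
    obtain ⟨L, hL, -⟩ := exists_isFiniteUnramified_of_subalgebra (K := K) (⊥ : Subalgebra R Ω)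
    exact ⟨L, hL⟩
  have := hne.to_subtype
  have hdir : Directed (· ≤ ·) (Subtype.val : {L | IsFiniteUnramified R K Ω L} → _) := by
    intro L₁ L₂
    obtain ⟨L, hL, h1, h2⟩ := L₁.2.exists_sup_le L₂.2
    exact ⟨⟨L, hL⟩, h1, h2⟩
  rw [maxUnramified, sSup_eq_iSup', ← SetLike.mem_coe,
    IntermediateField.coe_iSup_of_directed hdir, Set.mem_iUnion] at h
  obtain ⟨L, hL⟩ := h
  exact ⟨L, L.2, hL⟩

end Unramified

/-! ### The residue field of a separable closure and the kernel of the reduction map -/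

section Reduction

variable {R K Ω : Type*} [CommRing R] [IsDomain R] [IsDiscreteValuationRing R]
  [IsAdicComplete (maximalIdeal R) R] [Field K] [Algebra R K] [IsFractionRing R K]
  [Field Ω] [Algebra K Ω] [Algebra R Ω] [IsScalarTower R K Ω]

theorem reduction_residue (σ : Gal(Ω/K)) (x y : integralClosure R Ω) (h : σ x = y) :
    reduction R K Ω σ (residue _ x) = residue _ y := by
  have : y = (σ.restrictScalars R).mapIntegralClosure x := Subtype.ext h.symm
  rw [this]
  rfl

theorem residue_aeval (x : integralClosure R Ω) (f : R[X]) :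
    residue _ (aeval x f) = aeval (residue _ x) (f.map (residue R)) := by
  rw [aeval_def, hom_eval₂, aeval_def, eval₂_map]
  rfl

variable (R Ω) in
theorem resField_isIntegral : Algebra.IsIntegral (ResidueField R) (resField R Ω) := by
  refine ⟨fun x ↦ ?_⟩
  obtain ⟨x, rfl⟩ := residue_surjective x
  have h : IsIntegral R (residue (integralClosure R Ω) x) :=
    (Algebra.IsIntegral.isIntegral (R := R) x).map (IsScalarTower.toAlgHom R _ (resField R Ω))
  exact h.tower_top

-- local, so that this instance plays no part in elaborating statements outside the section
attribute [local instance] resField_isIntegral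

variable (R Ω) in
theorem charP_resField (p : ℕ) [CharP (ResidueField R) p] : CharP (resField R Ω) p :=
  charP_of_injective_algebraMap (algebraMap (ResidueField R) (resField R Ω)).injective p

theorem exists_monic_lift {S : Type*} [CommRing S] [IsLocalRing S] (f : (ResidueField S)[X])
    (hf : f.Monic) : ∃ g : S[X], g.map (residue S) = f ∧ g.natDegree = f.natDegree ∧ g.Monic :=
  lifts_and_natDegree_eq_and_monic
    ((mem_lifts f).2 (map_surjective _ residue_surjective f)) hf

/-- If `f x = 0` and `f' x` is a unit of `R[x]`, then `R[x]` is unramified over `R`: by Newton's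
expansion, two roots of `f` that agree modulo an ideal of square zero are equal if `f'` is a unit
there. -/
theorem formallyUnramified_adjoin_of_isUnit {R A : Type*} [CommRing R] [CommRing A] [Algebra R A]
    (x : A) (f : R[X]) (hf : aeval x f = 0)
    (hu : IsUnit (aeval (⟨x, Algebra.self_mem_adjoin_singleton R x⟩ : Algebra.adjoin R {x})
      (derivative f))) :
    Algebra.FormallyUnramified R (Algebra.adjoin R {x}) := by
  set y : Algebra.adjoin R {x} := ⟨x, Algebra.self_mem_adjoin_singleton R x⟩ with hy
  have hfy : aeval y f = 0 := by
    apply Subtype.val_injective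
    change (Algebra.adjoin R {x}).val _ = 0
    rw [← aeval_algHom_apply]
    exact hf
  rw [Algebra.FormallyUnramified.iff_comp_injective]
  intro C _ _ I hI g₁ g₂ h
  have hmem : g₂ y - g₁ y ∈ I := by
    rw [← Ideal.Quotient.eq]
    exact (DFunLike.congr_fun h y).symm
  have key : g₁ y = g₂ y := by
    have h1 : aeval (g₁ y) f = 0 := by rw [aeval_algHom_apply, hfy, map_zero]
    have h2 : aeval (g₂ y) f = 0 := by rw [aeval_algHom_apply, hfy, map_zero]
    have hu' : IsUnit (aeval (g₁ y) (derivative f)) := by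
      rw [aeval_algHom_apply]
      exact hu.map g₁
    obtain ⟨z, hz⟩ := (f.map (algebraMap R C)).binomExpansion (g₁ y) (g₂ y - g₁ y)
    rw [add_sub_cancel, eval_map_algebraMap, eval_map_algebraMap, h1, h2, derivative_map,
      eval_map_algebraMap] at hz
    have h3 : (g₂ y - g₁ y) ^ 2 = 0 := by
      have := Ideal.pow_mem_pow hmem 2
      rwa [hI] at this
    rw [h3, mul_zero, add_zero, zero_add] at hz
    exact (sub_eq_zero.1 ((hu'.mul_right_eq_zero).1 hz.symm)).symm
  refine AlgHom.adjoin_ext fun z hz ↦ ?_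
  obtain rfl := Set.mem_singleton_iff.1 hz
  exact key

theorem isUnit_of_isUnit_map_of_isIntegral {R A B : Type*} [CommRing R] [CommRing A] [CommRing B]
    [Algebra R A] [Algebra R B] [Algebra.IsIntegral R B] (f : A →ₐ[R] B)
    (hf : Function.Injective f) {a : A} (h : IsUnit (f a)) : IsUnit a := by
  let _ := f.toRingHom.toAlgebra
  have : IsScalarTower R A B := IsScalarTower.of_algebraMap_eq' f.comp_algebraMap.symm
  have : Algebra.IsIntegral A B := Algebra.IsIntegral.tower_top R
  have : FaithfulSMul A B := (faithfulSMul_iff_algebraMap_injective _ _).2 hf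
  exact (isUnit_map_iff (algebraMap A B) a).1 h

section SepClosed

variable [IsSepClosed Ω]

/-- In a separably closed field, every element of the residue field that is separable over the
residue field of `R` lifts to an element of the maximal unramified extension. -/
theorem exists_mem_maxUnramified_residue_eq (a : resField R Ω)
    (ha : IsSeparable (ResidueField R) a) :
    ∃ x : integralClosure R Ω, (x : Ω) ∈ maxUnramified R K Ω ∧ residue _ x = a := by
  have hai : IsIntegral (ResidueField R) a := Algebra.IsIntegral.isIntegral a
  obtain ⟨f, hfa, -, hf⟩ := exists_monic_lift (S := R) _ (minpoly.monic hai)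
  have hirr : Irreducible f := hf.irreducible_of_irreducible_map (residue R) f
    (hfa ▸ minpoly.irreducible hai)
  have hirrK : Irreducible (f.map (algebraMap R K)) :=
    (hf.irreducible_iff_irreducible_map_fraction_map (K := K)).1 hirr
  have hder : derivative f ≠ 0 := by
    intro h
    have h1 := (separable_iff_derivative_ne_zero (minpoly.irreducible hai)).1 ha
    rw [← hfa, derivative_map, h, Polynomial.map_zero] at h1
    exact h1 rfl
  have hsepK : (f.map (algebraMap R K)).Separable := by
    rw [separable_iff_derivative_ne_zero hirrK, derivative_map, Ne,
      Polynomial.map_eq_zero_iff (IsFractionRing.injective R K)]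
    exact hder
  have hspl : (f.map (algebraMap R Ω)).Splits := by
    rw [IsScalarTower.algebraMap_eq R K Ω, ← Polynomial.map_map]
    exact IsSepClosed.splits_of_separable _ (hsepK.map)
  -- the roots of `f` in `Ω` are integral, and their residues are the roots of its reduction
  have hroot : ∃ x : integralClosure R Ω, aeval x f = 0 ∧ residue _ x = a := by
    obtain ⟨t, ht⟩ : ∃ t : Multiset (integralClosure R Ω),
        t.map (algebraMap _ Ω) = (f.map (algebraMap R Ω)).roots := by
      refine ⟨(f.map (algebraMap R Ω)).roots.pmap Subtype.mk fun x hx ↦ ⟨f, hf, ?_⟩, ?_⟩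
      · exact (eval_map _ _).symm.trans (isRoot_of_mem_roots hx)
      · exact (Multiset.map_pmap _ _ _ _).trans
          ((Multiset.pmap_eq_map _ _ _ _).trans (Multiset.map_id _))
    have hprod : f.map (algebraMap R (integralClosure R Ω)) = (t.map fun x ↦ X - C x).prod := by
      refine Polynomial.map_injective (algebraMap (integralClosure R Ω) Ω) Subtype.val_injective ?_
      rw [Polynomial.map_map, ← IsScalarTower.algebraMap_eq, Polynomial.map_multiset_prod,
        Multiset.map_map, hspl.eq_prod_roots_of_monic (hf.map _), ← ht, Multiset.map_map]
      simp [Function.comp_def]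
    obtain ⟨b, rfl⟩ := residue_surjective a
    have hb : residue _ (aeval b f) = 0 := by
      rw [residue_aeval, hfa]
      exact minpoly.aeval _ _
    rw [aeval_def, ← eval_map, hprod, eval_multiset_prod, Multiset.map_map, map_multiset_prod,
      Multiset.map_map, Multiset.prod_eq_zero_iff, Multiset.mem_map] at hb
    obtain ⟨x, hxt, hxb⟩ := hb
    refine ⟨x, ?_, ?_⟩
    swap
    · have : residue _ (b - x) = 0 := by simpa using hxb
      rw [map_sub] at this
      exact (sub_eq_zero.1 this).symm
    rw [aeval_def, ← eval_map, hprod, eval_multiset_prod, Multiset.prod_eq_zero_iff,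
      Multiset.map_map]
    exact Multiset.mem_map.2 ⟨x, hxt, by simp⟩
  obtain ⟨x, hx, rfl⟩ := hroot
  have hxΩ : aeval (x : Ω) f = 0 := by
    have := congrArg (integralClosure R Ω).val hx
    rwa [← aeval_algHom_apply, map_zero] at this
  -- `f' x` is a unit because its residue is the derivative of a separable polynomial at a root
  let B := Algebra.adjoin R {(x : Ω)}
  have : Module.Finite R B := Algebra.finite_adjoin_simple_of_isIntegral x.2
  have : Algebra.FormallyUnramified R B := by
    refine formallyUnramified_adjoin_of_isUnit (x : Ω) f hxΩ ?_
    let j : B →ₐ[R] integralClosure R Ω := B.val.codRestrict _ fun b ↦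
      (Algebra.IsIntegral.isIntegral (R := R) b).map B.val
    refine isUnit_of_isUnit_map_of_isIntegral j
      (fun _ _ h ↦ Subtype.val_injective (congrArg (algebraMap _ Ω) h)) ?_
    rw [← aeval_algHom_apply, ← residue_ne_zero_iff_isUnit]
    change residue _ (aeval x (derivative f)) ≠ 0
    rw [residue_aeval, ← derivative_map, hfa]
    exact Separable.aeval_derivative_ne_zero ha (minpoly.aeval (ResidueField R) _)
  obtain ⟨L, hL, hBL⟩ := exists_isFiniteUnramified_of_subalgebra (K := K) B
  exact ⟨x, le_sSup (a := L) hL (hBL _ (Algebra.self_mem_adjoin_singleton R _)), rfl⟩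

variable (R Ω) in
/-- The residue field of a separably closed field is algebraically closed. In characteristic `p` a
root of a lifted polynomial need only exist up to a power of Frobenius, and the residue field is
perfect because the separable polynomial `X ^ p + ϖ X - a` reduces to `X ^ p - a`. -/
theorem resField_isAlgClosed (p : ℕ) [Fact p.Prime] [CharP (ResidueField R) p] [FaithfulSMul R Ω] :
    IsAlgClosed (resField R Ω) := by
  have := charP_resField R Ω p
  have hp : p.Prime := Fact.out
  have hinj : Function.Injective (algebraMap (integralClosure R Ω) Ω) := Subtype.val_injective
  -- an element of `Ω` that is a root of a monic polynomial over its integers has a residue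
  have hint (g : (integralClosure R Ω)[X]) (hg : g.Monic) (x : Ω) (hx : aeval x g = 0) :
      ∃ y : integralClosure R Ω, eval y g = 0 ∧ (y : Ω) = x := by
    have : IsIntegral (integralClosure R Ω) x := ⟨g, hg, hx⟩
    refine ⟨⟨x, isIntegral_trans x this⟩, hinj ?_, rfl⟩
    rw [map_zero, ← hx]
    exact (aeval_algebraMap_apply_eq_algebraMap_eval
      (⟨x, isIntegral_trans x this⟩ : integralClosure R Ω) g).symm
  have hdeg {k : Type _} [Field k] (f : (integralClosure R Ω) →+* k) (g : (integralClosure R Ω)[X])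
      (hg : g.natDegree ≠ 0) (hgm : g.Monic) : (g.map f).degree ≠ 0 := by
    rw [hgm.degree_map, degree_eq_natDegree hgm.ne_zero]
    exact_mod_cast hg
  refine IsAlgClosed.of_exists_root _ fun f hf hfi ↦ ?_
  obtain ⟨g, rfl, hgd, hg⟩ := exists_monic_lift f hf
  have hg0 : g.natDegree ≠ 0 := hgd ▸ hfi.natDegree_pos.ne'
  obtain ⟨q, hq⟩ := CharP.exists Ω
  rcases CharP.char_is_prime_or_zero Ω q with hq' | rfl
  -- equal characteristic: `Ω` need not be algebraically closed
  · have hqO : CharP (integralClosure R Ω) q := (RingHom.charP_iff _ hinj q).2 hq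
    obtain rfl : q = p := by
      have h1 : (q : resField R Ω) = 0 := by
        rw [← map_natCast (residue (integralClosure R Ω)), CharP.cast_eq_zero, map_zero]
      exact ((Nat.prime_dvd_prime_iff_eq hp hq').1 ((CharP.cast_eq_zero_iff _ p q).1 h1)).symm
    have : ExpChar Ω q := .prime hp
    have : ExpChar (integralClosure R Ω) q := .prime hp
    have : ExpChar (resField R Ω) q := .prime hp
    have hperf : PerfectRing (resField R Ω) q := by
      refine PerfectRing.ofSurjective _ q fun a ↦ ?_
      obtain ⟨a, rfl⟩ := residue_surjective a
      obtain ⟨ϖ, hϖ⟩ := IsDiscreteValuationRing.exists_irreducible R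
      have hϖ0 : algebraMap R Ω ϖ ≠ 0 := by
        rw [Ne, map_eq_zero_iff _ (FaithfulSMul.algebraMap_injective R Ω)]
        exact hϖ.ne_zero
      obtain ⟨x, hx⟩ := IsSepClosed.exists_root_C_mul_X_pow_add_C_mul_X_add_C' q q
        1 (algebraMap R Ω ϖ) (-(a : Ω)) dvd_rfl hp.two_le hϖ0
      have hm : (X ^ q + (C (algebraMap R _ ϖ) * X - C a) : (integralClosure R Ω)[X]).Monic :=
        (monic_X_pow q).add_of_left (by
          rw [degree_X_pow]
          refine lt_of_le_of_lt
            (degree_linear_le (a := algebraMap R _ ϖ) (b := -a)) ?_ |>.trans_eq' ?_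
          · exact_mod_cast hp.one_lt
          · simp [sub_eq_add_neg])
      obtain ⟨y, hy, -⟩ := hint _ hm x (by
        rw [← hx]
        simp [← sub_eq_add_neg, add_sub_assoc])
      have hϖF : residue (integralClosure R Ω) (algebraMap R _ ϖ) = 0 := by
        have : residue R ϖ = 0 := (residue_eq_zero_iff ϖ).2 hϖ.not_isUnit
        exact (congrArg (algebraMap (ResidueField R) (resField R Ω)) this).trans (map_zero _)
      refine ⟨residue _ y, ?_⟩
      have := congrArg (residue (integralClosure R Ω)) hy
      simp only [eval_add, eval_sub, eval_mul, eval_pow, eval_X, eval_C, map_add, map_sub, map_mul,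
        map_pow, map_zero, hϖF, zero_mul, zero_sub] at this
      rw [frobenius_def]
      linear_combination this
    obtain ⟨x, hx⟩ := IsAlgClosed.exists_root
      (g.map (algebraMap (integralClosure R Ω) (AlgebraicClosure Ω))) (hdeg _ g hg0 hg)
    -- a `q ^ n`-th power `y` of a root lies in `Ω`; it is a root of the Frobenius twist of `g`, and
    -- the `q ^ n`-th root of its residue is a root of the reduction of `g`
    obtain ⟨n, y, hy⟩ := IsPurelyInseparable.pow_mem Ω q x
    have hgy : aeval y (g.map (iterateFrobenius _ q n)) = 0 := by
      refine (algebraMap Ω (AlgebraicClosure Ω)).injective ?_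
      rw [map_zero, ← aeval_algebraMap_apply, hy, ← expand_aeval, ← map_expand,
        map_iterateFrobenius_expand, map_pow]
      rw [IsRoot, eval_map_algebraMap] at hx
      rw [hx, zero_pow (pow_ne_zero _ hp.ne_zero)]
    obtain ⟨y, hy0, rfl⟩ := hint _ (hg.map _) y hgy
    obtain ⟨z, hz⟩ := (bijective_iterateFrobenius (resField R Ω) q n).2 (residue _ y)
    refine ⟨z, (iterateFrobenius_inj (resField R Ω) q n) ?_⟩
    rw [map_zero, ← eval₂_at_apply, hz, eval₂_map]
    have := congrArg (residue (integralClosure R Ω)) hy0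
    rw [eval_map, hom_eval₂, map_zero] at this
    rw [← this]
    congr 1
  -- in characteristic zero `Ω` is algebraically closed
  · have : CharZero Ω := CharP.charP_to_charZero Ω
    obtain ⟨x, hx⟩ := IsAlgClosed.exists_root (g.map (algebraMap (integralClosure R Ω) Ω))
      (hdeg _ g hg0 hg)
    rw [IsRoot, eval_map_algebraMap] at hx
    obtain ⟨y, hy, -⟩ := hint g hg x hx
    exact ⟨residue _ y, by rw [eval_map_apply, hy, map_zero]⟩

end SepClosed

/-- The separable elements of the residue field lift to the maximal unramified extension, and the
rest of the residue field is purely inseparable over them. -/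
theorem reduction_eq_one_of_fixes_maxUnramified [IsSepClosed Ω]
    (p : ℕ) [Fact p.Prime] [CharP (ResidueField R) p] (σ : Gal(Ω/K))
    (h : ∀ x ∈ maxUnramified R K Ω, σ x = x) : reduction R K Ω σ = 1 := by
  have := charP_resField R Ω p
  have : ExpChar (ResidueField R) p := .prime Fact.out
  have : ExpChar (resField R Ω) p := .prime Fact.out
  have : ExpChar (separableClosure (ResidueField R) (resField R Ω)) p :=
    expChar_of_injective_algebraMap (algebraMap (ResidueField R) _).injective p
  ext a
  obtain ⟨n, b, hb⟩ := IsPurelyInseparable.pow_mem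
    (separableClosure (ResidueField R) (resField R Ω)) p a
  obtain ⟨x, hx, hxb⟩ := exists_mem_maxUnramified_residue_eq (K := K) (b : resField R Ω)
    (mem_separableClosure_iff.1 b.2)
  have h1 : reduction R K Ω σ (a ^ p ^ n) = a ^ p ^ n := by
    rw [← hb]
    change reduction R K Ω σ b = b
    rw [← hxb]
    exact reduction_residue σ x x (h x hx)
  rw [map_pow] at h1
  exact iterateFrobenius_inj _ p n h1

/-- For `L` finite unramified, `σ` and the identity induce two maps from the ring of integers of `L`
to that of a finite extension that agree modulo the maximal ideal, so they coincide. -/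
theorem fixes_maxUnramified_of_reduction_eq_one [Algebra.IsSeparable K Ω] (σ : Gal(Ω/K))
    (h : reduction R K Ω σ = 1) (x : Ω) (hx : x ∈ maxUnramified R K Ω) : σ x = x := by
  obtain ⟨L, hL, hxL⟩ := (mem_maxUnramified_iff x).1 hx
  wlog hint : IsIntegral R x generalizing x
  · have := this x⁻¹ (inv_mem hx) (inv_mem hxL)
      ((isIntegral_or_isIntegral_inv R K x).resolve_left hint)
    rwa [map_inv₀, inv_inj] at this
  have := hL.1
  have hu := hL.2
  let M := L ⊔ L.map (σ : Ω →ₐ[K] Ω)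
  have : FiniteDimensional K M := by
    have : FiniteDimensional K (L.map (σ : Ω →ₐ[K] Ω)) := (hL.map σ).1
    infer_instance
  have : IsNoetherianRing (integralClosure R M) := by
    have : IsDedekindDomain (integralClosure R M) := integralClosure.isDedekindDomain R K M
    infer_instance
  let i₁ : L →ₐ[R] M := (IntermediateField.inclusion le_sup_left).restrictScalars R
  let i₂ : L →ₐ[R] M := ((IntermediateField.inclusion le_sup_right).restrictScalars R).comp
    ((L.equivMap (σ : Ω →ₐ[K] Ω)).toAlgHom.restrictScalars R)
  let f : integralClosure R M →ₐ[R] integralClosure R Ω :=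
    (M.val.restrictScalars R).mapIntegralClosure
  have hg : i₁.mapIntegralClosure = i₂.mapIntegralClosure := by
    refine Algebra.FormallyUnramified.ext_of_iInf (maximalIdeal (integralClosure R M))
      (Ideal.iInf_pow_eq_bot_of_isLocalRing _ (maximalIdeal.isMaximal _).ne_top) fun y ↦ ?_
    rw [Ideal.Quotient.eq, mem_maximalIdeal]
    intro hunit
    have h1 := hunit.map f
    have h2 : residue _ (f (i₁.mapIntegralClosure y)) =
        residue _ (f (i₂.mapIntegralClosure y)) := by
      have := reduction_residue σ (f (i₁.mapIntegralClosure y)) (f (i₂.mapIntegralClosure y)) rfl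
      rw [← this, h]
      rfl
    rw [map_sub, ← residue_ne_zero_iff_isUnit, map_sub, h2, sub_self] at h1
    exact h1 rfl
  have hint' : IsIntegral R (⟨x, hxL⟩ : L) :=
    (isIntegral_algHom_iff (L.val.restrictScalars R) L.val.injective).1 hint
  have := congrArg (fun z : integralClosure R M ↦ (z : Ω)) (DFunLike.congr_fun hg ⟨_, hint'⟩)
  exact this.symm

end Reduction

/-! ### Surjectivity and continuity of the reduction map -/

section Galois

variable {R K Ω : Type*} [CommRing R] [IsDomain R] [IsDiscreteValuationRing R]
  [IsAdicComplete (maximalIdeal R) R] [Field K] [Algebra R K] [IsFractionRing R K]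
  [Field Ω] [Algebra K Ω] [Algebra R Ω] [IsScalarTower R K Ω] [IsGalois K Ω]

attribute [local instance] resField_isIntegral

variable (R K Ω) in
theorem reduction_surjective : Function.Surjective (reduction R K Ω) := by
  intro τ
  have : SMulCommClass Gal(Ω/K) R Ω := ⟨fun g r x ↦ (map_smul (g.restrictScalars R) r x)⟩
  -- the whole Galois group is the decomposition group of the maximal ideal, and it acts
  -- continuously on the discrete ring of integers with invariants `R`
  let _ : TopologicalSpace (integralClosure R Ω) := ⊥
  have : DiscreteTopology (integralClosure R Ω) := ⟨rfl⟩
  have : ContinuousSMul Gal(Ω/K) (integralClosure R Ω) := by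
    rw [continuousSMul_iff_stabilizer_isOpen]
    intro x
    convert! stabilizer_isOpen_of_isIntegral (K := K) (x : Ω)
    ext g
    simp [Subtype.ext_iff]
  have : Algebra.IsInvariant R (integralClosure R Ω) Gal(Ω/K) := by
    refine ⟨fun b hb ↦ ?_⟩
    have h1 : (b : Ω) ∈ Set.range (algebraMap K Ω) :=
      (InfiniteGalois.mem_range_algebraMap_iff_fixed _).2 fun g ↦ congrArg Subtype.val (hb g)
    obtain ⟨a, ha⟩ := h1
    have h2 : IsIntegral R a := by
      rw [← isIntegral_algebraMap_iff (B := Ω) (algebraMap K Ω).injective, ha]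
      exact b.2
    obtain ⟨r, rfl⟩ := IsIntegrallyClosed.isIntegral_iff.1 h2
    refine ⟨r, Subtype.ext ?_⟩
    rw [← ha, ← IsScalarTower.algebraMap_apply]
    rfl
  have : TotallyDisconnectedSpace Gal(Ω/K) := inferInstance
  obtain ⟨g, hg⟩ := Ideal.Quotient.stabilizerHom_surjective_of_profinite (G := Gal(Ω/K))
    (maximalIdeal R) (maximalIdeal (integralClosure R Ω))
    (AlgEquiv.ofRingEquiv (f := (τ : resField R Ω ≃+* resField R Ω)) (fun x ↦ by
      obtain ⟨x, rfl⟩ := Ideal.Quotient.mk_surjective x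
      exact τ.commutes (residue R x)))
  refine ⟨g, ?_⟩
  ext x
  obtain ⟨x, rfl⟩ := residue_surjective x
  rw [reduction_residue g.1 x (g.1 • x) rfl]
  exact congr($hg (Ideal.Quotient.mk _ x))

variable (R K) in
theorem isOpen_stabilizer_reduction (x : resField R Ω) :
    IsOpen {σ : Gal(Ω/K) | reduction R K Ω σ x = x} := by
  obtain ⟨x, rfl⟩ := residue_surjective x
  have : {σ : Gal(Ω/K) | reduction R K Ω σ (residue _ x) = residue _ x} =
      ((MulAction.stabilizer Gal(resField R Ω/ResidueField R) (residue _ x)).comap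
        (reduction R K Ω) : Set Gal(Ω/K)) := rfl
  rw [this]
  refine Subgroup.isOpen_mono (H₁ := MulAction.stabilizer Gal(Ω/K) (x : Ω)) (fun σ hσ ↦ ?_)
    (stabilizer_isOpen_of_isIntegral _)
  exact reduction_residue σ x x hσ

variable (R K Ω) in
theorem continuous_reduction : Continuous (reduction R K Ω) := by
  refine continuous_of_continuousAt_one _ ?_
  rw [ContinuousAt, map_one]
  intro s hs
  obtain ⟨E, hE, hEs⟩ := (krullTopology_mem_nhds_one_iff _ _ _).1 hs
  obtain ⟨t, rfl⟩ := (IntermediateField.essFiniteType_iff (K := E)).1 inferInstance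
  have hmem (x : resField R Ω) : {σ : Gal(Ω/K) | reduction R K Ω σ x = x} ∈ nhds 1 := by
    refine (isOpen_stabilizer_reduction R K x).mem_nhds ?_
    change reduction R K Ω 1 x = x
    rw [map_one, AlgEquiv.one_apply]
  rw [Filter.mem_map]
  refine Filter.mem_of_superset ((Filter.biInter_finset_mem t).2 fun x _ ↦ hmem x)
    fun σ hσ ↦ hEs ?_
  rw [Set.mem_iInter₂] at hσ
  rw [SetLike.mem_coe, IntermediateField.mem_fixingSubgroup_iff]
  exact (IntermediateField.forall_mem_adjoin_smul_eq_self_iff (ResidueField R)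
    (S := (t : Set (resField R Ω))) (reduction R K Ω σ)).2 hσ

end Galois

/-! ### Roots of the uniformizer and the pro-`p` part of the inertia group -/

section Tame

theorem eq_zero_of_zpow_eq_unit {R Ω : Type*} [CommRing R] [IsLocalRing R] [Field Ω]
    [Algebra R Ω] {ϖ : R} (hϖ : Irreducible ϖ) (u : (integralClosure R Ω)ˣ) (k : ℤ)
    (h : algebraMap R Ω ϖ ^ k = u) : k = 0 := by
  have h1 : ¬ IsUnit (algebraMap R (integralClosure R Ω) ϖ) :=
    fun h ↦ hϖ.not_isUnit (isUnit_of_map_unit _ _ h)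
  have key (n : ℕ) (v : (integralClosure R Ω)ˣ) (hv : algebraMap R Ω ϖ ^ n = v) : n = 0 := by
    by_contra hn
    have : algebraMap R (integralClosure R Ω) ϖ ^ n = v := Subtype.ext hv
    exact h1 ((isUnit_pow_iff hn).1 (this ▸ v.isUnit))
  obtain ⟨n, rfl | rfl⟩ := k.eq_nat_or_neg
  · rw [zpow_natCast] at h
    exact_mod_cast key n u h
  · rw [zpow_neg, zpow_natCast, inv_eq_iff_eq_inv] at h
    have h2 : (u.1 : Ω)⁻¹ = (u⁻¹).1 :=
      (eq_inv_of_mul_eq_one_left (congrArg Subtype.val u.inv_mul)).symm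
    simpa using key n u⁻¹ (h.trans h2)

variable {R K Ω : Type*} [CommRing R] [IsDomain R] [IsDiscreteValuationRing R]
  [IsAdicComplete (maximalIdeal R) R] [Field K] [Algebra R K] [IsFractionRing R K]
  [Field Ω] [Algebra K Ω] [Algebra R Ω] [IsScalarTower R K Ω]

/-- Suppose `σ` multiplies each nonzero element by a principal unit. If `σ ^ n` fixes `y`, with `n`
prime to the residue characteristic, then so does `σ`: the conjugates of `x = y - σ y` under the
powers of `σ` sum to zero, while their sum is `x` times an element with residue `n`. -/
theorem apply_eq_of_pow_apply_eq (σ : Gal(Ω/K))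
    (hmul : ∀ x : Ω, x ≠ 0 → ∃ v : integralClosure R Ω, residue _ v = 1 ∧ σ x = v * x)
    {n : ℕ} (hn : (n : resField R Ω) ≠ 0) {y : Ω} (hy : (σ ^ n) y = y) : σ y = y := by
  by_contra hne
  obtain ⟨v, hv, hvx⟩ := hmul (y - σ y) (sub_ne_zero.2 (Ne.symm hne))
  have hi (i : ℕ) : ∃ w : integralClosure R Ω, residue _ w = 1 ∧
      (σ ^ i) (y - σ y) = w * (y - σ y) := by
    induction i with
    | zero => exact ⟨1, map_one _, by simp⟩
    | succ i ih =>
      obtain ⟨w, hw, hwx⟩ := ih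
      refine ⟨(σ.restrictScalars R).mapIntegralClosure w * v, ?_, ?_⟩
      · rw [map_mul, hv, mul_one, ← reduction_residue σ w _ rfl, hw, map_one]
      · rw [pow_succ', AlgEquiv.mul_apply, hwx, map_mul, hvx, ← mul_assoc]
        rfl
  choose w hw hwx using hi
  have hsum : (∑ i ∈ Finset.range n, (w i : Ω)) * (y - σ y) = 0 := by
    rw [Finset.sum_mul]
    simp_rw [← hwx, map_sub, ← AlgEquiv.mul_apply, ← pow_succ]
    rw [Finset.sum_range_sub', hy, pow_zero, AlgEquiv.one_apply, sub_self]
  have h0 : ∑ i ∈ Finset.range n, w i = 0 := Subtype.ext (by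
    push_cast
    exact (mul_eq_zero.1 hsum).resolve_right (sub_ne_zero.2 (Ne.symm hne)))
  apply hn
  have := congrArg (residue _) h0
  rw [map_sum, map_zero] at this
  simpa [hw] using this

/-- A tower of roots of `a` whose orders are prime to `p` and are divisible by every given integer
prime to `p`. -/
theorem exists_root_sequence [IsSepClosed Ω] (p : ℕ) [Fact p.Prime] [CharP (ResidueField R) p]
    (a : Ω) :
    ∃ (ρ : ℕ → Ω) (m : ℕ → ℕ), (∀ i, m i ≠ 0 ∧ ρ i ^ m i = a) ∧
      (∀ i, ∃ n, ρ (i + 1) ^ n = ρ i) ∧ ∀ n, ¬ p ∣ n → ∃ i, n ∣ m i := by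
  have := charP_resField R Ω p
  have hroot (x : Ω) (i : ℕ) : ∃ y : Ω, y ^ (if p ∣ i then 1 else i) = x := by
    split_ifs with h
    · exact ⟨x, pow_one x⟩
    · have : NeZero (i : Ω) := ⟨fun h0 ↦ h <| by
        have h1 : (i : integralClosure R Ω) = 0 := Subtype.ext (by simpa using h0)
        rw [← CharP.cast_eq_zero_iff (resField R Ω), ← map_natCast (residue _), h1, map_zero]⟩
      exact IsSepClosed.exists_pow_nat_eq x i
  choose r hr using hroot
  -- the step from `ρ i` to `ρ (i + 1)` extracts an `i`-th root if `p` does not divide `i`, and does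
  -- nothing otherwise
  let ρ : ℕ → Ω := fun i ↦ Nat.rec a (fun i x ↦ r x i) i
  refine ⟨ρ, fun i ↦ ∏ j ∈ Finset.range i, if p ∣ j then 1 else j, fun i ↦ ⟨?_, ?_⟩,
    fun i ↦ ⟨_, hr (ρ i) i⟩, fun n hn ↦ ⟨n + 1, ?_⟩⟩
  · refine Finset.prod_ne_zero_iff.2 fun j _ ↦ ?_
    split_ifs with h
    · exact one_ne_zero
    · rintro rfl
      exact h (dvd_zero p)
  · induction i with
    | zero => simp [ρ]
    | succ i ih =>
      beta_reduce
      rw [Finset.prod_range_succ, mul_comm, pow_mul]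
      exact (congrArg (· ^ _) (hr (ρ i) i)).trans ih
  · have := Finset.dvd_prod_of_mem (fun j ↦ if p ∣ j then 1 else j)
      (Finset.mem_range.2 (Nat.lt_succ_self n))
    rwa [if_neg hn] at this

variable [IsGalois K Ω]

/-- `X ^ m - ϖ` is irreducible over the maximal unramified extension, where `ϖ` has valuation one:
the norm `c` of a root `ρ` of degree `d` satisfies `c ^ m = ϖ ^ d`, so `m` divides `d`. -/
theorem minpoly_maxUnramified_root {ϖ : R} (hϖ : Irreducible ϖ) {m : ℕ} (hm : m ≠ 0) {ρ : Ω}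
    (hρ : ρ ^ m = algebraMap R Ω ϖ) :
    minpoly (maxUnramified R K Ω) ρ = X ^ m - C (algebraMap R (maxUnramified R K Ω) ϖ) := by
  let E := maxUnramified R K Ω
  have : IsScalarTower R E Ω := IsScalarTower.of_algebraMap_eq fun x ↦ by
    rw [IsScalarTower.algebraMap_apply R K E, IsScalarTower.algebraMap_apply R K Ω]
    rfl
  have hϖ0 : algebraMap R Ω ϖ ≠ 0 := by
    rw [Ne, map_eq_zero_iff _ (algebraMap_injective_of_tower R K Ω)]
    exact hϖ.ne_zero
  have hρint : IsIntegral E ρ := (Algebra.IsIntegral.isIntegral (R := K) ρ).tower_top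
  have hfin : FiniteDimensional E (IntermediateField.adjoin E {ρ}) :=
    IntermediateField.adjoin.finiteDimensional hρint
  have hmonic : (X ^ m - C (algebraMap R E ϖ)).Monic := monic_X_pow_sub_C _ hm
  have haev : aeval ρ (X ^ m - C (algebraMap R E ϖ)) = 0 := by
    rw [map_sub, map_pow, aeval_X, aeval_C, hρ, ← IsScalarTower.algebraMap_apply, sub_self]
  let g : IntermediateField.adjoin E {ρ} := IntermediateField.AdjoinSimple.gen E ρ
  let c : E := Algebra.norm E g
  have hg : g ^ m = algebraMap E _ (algebraMap R E ϖ) := by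
    apply Subtype.ext
    change ρ ^ m = algebraMap E Ω (algebraMap R E ϖ)
    rw [hρ, ← IsScalarTower.algebraMap_apply]
  have hc : c ^ m = algebraMap R E ϖ ^ (minpoly E ρ).natDegree := by
    rw [← map_pow, hg, Algebra.norm_algebraMap, IntermediateField.adjoin.finrank hρint]
  have hc' : (c : Ω) ^ m = algebraMap R Ω ϖ ^ (minpoly E ρ).natDegree := by
    have := congrArg (algebraMap E Ω) hc
    rwa [map_pow, map_pow, ← IsScalarTower.algebraMap_apply] at this
  have hc0 : (c : Ω) ≠ 0 := fun h ↦ by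
    rw [h, zero_pow hm] at hc'
    exact pow_ne_zero _ hϖ0 hc'.symm
  obtain ⟨L, hL, hcL⟩ := (mem_maxUnramified_iff (c : Ω)).1 c.2
  have := hL.1
  obtain ⟨e, -, he, h⟩ := exists_pow_eq_unit_mul_zpow_of_finiteDimensional hϖ L
  obtain rfl := he hL
  obtain ⟨u, k, hu⟩ := h c hcL hc0
  have hd : ((minpoly E ρ).natDegree : ℤ) - k * m = 0 := by
    refine eq_zero_of_zpow_eq_unit hϖ (u ^ m) _ ?_
    rw [zpow_sub₀ hϖ0, zpow_natCast, ← hc', zpow_mul, zpow_natCast, ← pow_one (c : Ω), hu, mul_pow]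
    field_simp
    simp
  have hdvd : m ∣ (minpoly E ρ).natDegree := by
    rw [← Int.natCast_dvd_natCast]
    exact ⟨k, by linarith⟩
  refine Eq.symm (eq_of_monic_of_dvd_of_natDegree_le (minpoly.monic hρint) hmonic
    (minpoly.dvd _ _ haev) ?_)
  rw [natDegree_X_pow_sub_C]
  exact Nat.le_of_dvd (minpoly.natDegree_pos hρint) hdvd

/-- The Galois group of `Ω` over the maximal unramified extension permutes the `m`-th roots of the
uniformizer transitively, so `g` can be corrected to fix a given one. -/
theorem exists_fixes_root {ϖ : R} (hϖ : Irreducible ϖ) {m : ℕ} (hm : m ≠ 0)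
    {ρ : Ω} (hρ : ρ ^ m = algebraMap R Ω ϖ) (g : Gal(Ω/K)) :
    ∃ h : Gal(Ω/K), h ρ = ρ ∧ ∀ x ∈ maxUnramified R K Ω, h x = g x := by
  have hρ' : (g⁻¹ ρ) ^ m = algebraMap R Ω ϖ := by
    rw [← map_pow, hρ]
    exact (g⁻¹.restrictScalars R).commutes ϖ
  have := (minpoly_maxUnramified_root (K := K) hϖ hm hρ').trans
    (minpoly_maxUnramified_root hϖ hm hρ).symm
  have hN : Normal (maxUnramified R K Ω) Ω := Normal.tower_top_of_normal K _ _
  obtain ⟨τ, hτ⟩ := (Normal.minpoly_eq_iff_mem_orbit _).1 this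
  refine ⟨g * τ.restrictScalars K, ?_, fun x hx ↦ ?_⟩
  · change g (τ • ρ) = ρ
    rw [show τ • ρ = g⁻¹ ρ from hτ]
    exact g.apply_symm_apply ρ
  · exact congrArg g (τ.commutes ⟨x, hx⟩)

theorem isClosed_setOf_apply_eq (x y : Ω) : IsClosed {g : Gal(Ω/K) | g x = y} := by
  rcases Set.eq_empty_or_nonempty {g : Gal(Ω/K) | g x = y} with h | ⟨g₀, rfl⟩
  · rw [h]
    exact isClosed_empty
  · have : {g : Gal(Ω/K) | g x = g₀ x} =
        (fun g ↦ g₀⁻¹ * g) ⁻¹' (MulAction.stabilizer Gal(Ω/K) x : Set Gal(Ω/K)) := by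
      ext g
      exact (inv_smul_eq_iff (g := g₀) (b := x) (a := g x)).symm
    rw [this]
    exact (Subgroup.isClosed_of_isOpen _ (stabilizer_isOpen_of_isIntegral x)).preimage
      (continuous_const_mul g₀⁻¹)

/-- By compactness, `g` can be corrected to fix a whole tower of roots of the uniformizer, without
changing it on the maximal unramified extension. -/
theorem exists_fixes_root_sequence {ϖ : R} (hϖ : Irreducible ϖ) {ρ : ℕ → Ω} {m : ℕ → ℕ}
    (hm : ∀ i, m i ≠ 0 ∧ ρ i ^ m i = algebraMap R Ω ϖ) (hρ : ∀ i, ∃ n, ρ (i + 1) ^ n = ρ i)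
    (g : Gal(Ω/K)) :
    ∃ h : Gal(Ω/K), (∀ i, h (ρ i) = ρ i) ∧ ∀ x ∈ maxUnramified R K Ω, h x = g x := by
  let C (i : ℕ) : Set Gal(Ω/K) :=
    {h | h (ρ i) = ρ i} ∩ ⋂ x ∈ maxUnramified R K Ω, {h | h x = g x}
  have hC (i) : IsClosed (C i) := (isClosed_setOf_apply_eq _ _).inter
    (isClosed_biInter fun x _ ↦ isClosed_setOf_apply_eq _ _)
  obtain ⟨h, hh⟩ := IsCompact.nonempty_iInter_of_sequence_nonempty_isCompact_isClosed C
    (fun i ↦ Set.inter_subset_inter_left _ fun h hh ↦ by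
      obtain ⟨n, hn⟩ := hρ i
      change h _ = _ at hh
      change h _ = _
      rw [← hn, map_pow, hh])
    (fun i ↦ by
      obtain ⟨h, h1, h2⟩ := exists_fixes_root hϖ (hm i).1 (hm i).2 g
      exact ⟨h, h1, Set.mem_iInter₂.2 h2⟩)
    (hC 0).isCompact hC
  rw [Set.mem_iInter] at hh
  exact ⟨h, fun i ↦ (hh i).1, Set.mem_iInter₂.1 (hh 0).2⟩

/-- If `σ` reduces to the identity and fixes an `m`-th root of the uniformizer for each `m` prime to
`p`, then `σ x / x` is a principal unit for every `x ≠ 0`. The `p ^ a`-th power of this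
quotient, for a suitable `a`, is `σ y / y` for a unit `y`, and the Frobenius of the residue field is injective. -/
theorem exists_apply_eq_mul (p : ℕ) [Fact p.Prime] [CharP (ResidueField R) p] {ϖ : R}
    (hϖ : Irreducible ϖ) (σ : Gal(Ω/K)) (hσ : reduction R K Ω σ = 1)
    (hroot : ∀ m, ¬ p ∣ m → ∃ ρ : Ω, ρ ^ m = algebraMap R Ω ϖ ∧ σ ρ = ρ) (x : Ω) (hx : x ≠ 0) :
    ∃ v : integralClosure R Ω, residue _ v = 1 ∧ σ x = v * x := by
  have := charP_resField R Ω p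
  have : ExpChar (resField R Ω) p := .prime Fact.out
  have hϖ0 : algebraMap R Ω ϖ ≠ 0 := by
    rw [Ne, map_eq_zero_iff _ (algebraMap_injective_of_tower R K Ω)]
    exact hϖ.ne_zero
  have hfin : FiniteDimensional K (IntermediateField.adjoin K {x}) :=
    IntermediateField.adjoin.finiteDimensional (Algebra.IsIntegral.isIntegral x)
  obtain ⟨e, he, -, h⟩ := exists_pow_eq_unit_mul_zpow_of_finiteDimensional hϖ
    (IntermediateField.adjoin K {x})
  obtain ⟨u, k, hu⟩ := h x (IntermediateField.mem_adjoin_simple_self K x) hx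
  obtain ⟨a, m, hpm, rfl⟩ := Nat.exists_eq_pow_mul_and_not_dvd he p (Fact.out : p.Prime).ne_one
  obtain ⟨ρ, hρ, hσρ⟩ := hroot m hpm
  have hm : m ≠ 0 := right_ne_zero_of_mul he
  have hρ0 : ρ ≠ 0 := by
    rintro rfl
    rw [zero_pow hm] at hρ
    exact hϖ0 hρ.symm
  -- with `e = p ^ a m`, dividing `x ^ (p ^ a)` by a power of `ρ` makes it a unit
  have hy : (x ^ p ^ a / ρ ^ k) ^ m = u := by
    rw [div_pow, ← pow_mul, hu, ← zpow_natCast (ρ ^ k), ← zpow_mul, mul_comm k, zpow_mul,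
      zpow_natCast, hρ]
    field_simp
  have hyint : IsIntegral R (x ^ p ^ a / ρ ^ k) :=
    IsIntegral.of_pow (Nat.pos_of_ne_zero hm) (hy ▸ u.1.2)
  let y : integralClosure R Ω := ⟨_, hyint⟩
  have hyu : IsUnit y := by
    have : y ^ m = u := Subtype.ext hy
    exact (isUnit_pow_iff hm).1 (this ▸ u.isUnit)
  obtain ⟨y', hy'⟩ := hyu.exists_right_inv
  let z : integralClosure R Ω := (σ.restrictScalars R).mapIntegralClosure y
  have hz : (σ x / x) ^ p ^ a * y = z := by
    change (σ x / x) ^ p ^ a * (x ^ p ^ a / ρ ^ k) = σ (x ^ p ^ a / ρ ^ k)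
    rw [map_div₀, map_pow, map_zpow₀, hσρ, div_pow]
    field_simp
  have hw : (σ x / x) ^ p ^ a = (z * y' : integralClosure R Ω) := by
    have : (y : Ω) * y' = 1 := congrArg Subtype.val hy'
    rw [MulMemClass.coe_mul, ← hz, mul_assoc, this, mul_one]
  have hwint : IsIntegral R (σ x / x) :=
    IsIntegral.of_pow (pow_pos (Fact.out : p.Prime).pos a) (hw ▸ (z * y').2)
  let w : integralClosure R Ω := ⟨_, hwint⟩
  refine ⟨w, ?_, (div_mul_cancel₀ _ hx).symm⟩
  have hw' : w ^ p ^ a = z * y' := Subtype.ext hw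
  have hzy : residue _ z = residue _ y := by
    rw [← reduction_residue σ y z rfl, hσ]
    rfl
  refine iterateFrobenius_inj _ p a ?_
  rw [iterateFrobenius_def, iterateFrobenius_def, ← map_pow, hw', map_mul, hzy, ← map_mul, hy',
    map_one, one_pow]

/-- The elements of the inertia group that fix a tower of tame roots of the uniformizer generate
pro-`p` groups. -/
theorem tendsto_pow_of_reduction_eq_one (p : ℕ) [Fact p.Prime] [CharP (ResidueField R) p] {ϖ : R}
    (hϖ : Irreducible ϖ) (σ : Gal(Ω/K)) (hσ : reduction R K Ω σ = 1)
    (hroot : ∀ m, ¬ p ∣ m → ∃ ρ : Ω, ρ ^ m = algebraMap R Ω ϖ ∧ σ ρ = ρ) :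
    Tendsto (fun k : ℕ ↦ σ ^ p ^ k) atTop (𝓝 1) := by
  have := charP_resField R Ω p
  intro s hs
  obtain ⟨N, hN, hN', hNs⟩ := (krullTopology_mem_nhds_one_iff_of_normal _ _ _).1 hs
  have hfix (τ : Gal(Ω/K)) (hτ : AlgEquiv.restrictNormalHom N τ = 1) (x : Ω) (hx : x ∈ N) :
      τ x = x := by
    rw [← MonoidHom.mem_ker, IntermediateField.restrictNormalHom_ker,
      IntermediateField.mem_fixingSubgroup_iff] at hτ
    exact hτ x hx
  -- if `σ` has order `p ^ a m` on the finite normal extension `N`, then `σ ^ (p ^ a)` is trivial on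
  -- `N`, because its `m`-th power is
  obtain ⟨a, m, hpm, ham⟩ := Nat.exists_eq_pow_mul_and_not_dvd
    (orderOf_pos (AlgEquiv.restrictNormalHom N σ)).ne' p (Fact.out : p.Prime).ne_one
  have hpow (j : ℕ) (x : Ω) (h : σ x = x) : (σ ^ j) x = x := by
    induction j with
    | zero => rfl
    | succ j ih => rw [pow_succ, AlgEquiv.mul_apply, h, ih]
  have hτ : reduction R K Ω (σ ^ p ^ a) = 1 := by rw [map_pow, hσ, one_pow]
  have hτfix (x : Ω) (hx : x ∈ N) : (σ ^ p ^ a) x = x := by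
    refine apply_eq_of_pow_apply_eq (R := R) _ (exists_apply_eq_mul p hϖ _ hτ fun m hm ↦ ?_)
      (n := m) ?_ ?_
    · obtain ⟨ρ, h1, h2⟩ := hroot m hm
      exact ⟨ρ, h1, hpow _ _ h2⟩
    · rwa [Ne, CharP.cast_eq_zero_iff _ p]
    · rw [← pow_mul, ← ham]
      exact hfix _ (by rw [map_pow, pow_orderOf_eq_one]) x hx
  rw [mem_map]
  filter_upwards [eventually_ge_atTop a] with k hk
  refine hNs ?_
  rw [SetLike.mem_coe, IntermediateField.mem_fixingSubgroup_iff]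
  intro x hx
  obtain ⟨b, rfl⟩ := Nat.exists_eq_add_of_le hk
  beta_reduce
  rw [pow_add, pow_mul]
  generalize p ^ b = j
  induction j with
  | zero => rfl
  | succ j ih =>
    rw [pow_succ]
    exact (congrArg ((σ ^ p ^ a) ^ j) (hτfix x hx)).trans ih

end Tame

/-! ### Splitting the reduction map -/

section Splitting

/-- A continuous bijective homomorphism from a compact group to a Hausdorff group is an isomorphism
of topological groups. -/
noncomputable def continuousMulEquivOfBijective {G H : Type*} [Group G] [TopologicalSpace G]
    [CompactSpace G] [Group H] [TopologicalSpace H] [T2Space H] (f : G →* H) (hf : Continuous f)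
    (hbij : Function.Bijective f) : G ≃ₜ* H where
  toMulEquiv := MulEquiv.ofBijective f hbij
  continuous_toFun := hf
  continuous_invFun := (Continuous.homeoOfEquivCompactToT2
    (f := (MulEquiv.ofBijective f hbij).toEquiv) hf).symm.continuous

/-- Two continuous surjective homomorphisms from a compact group to Hausdorff groups that have the
same kernel differ by an isomorphism of topological groups. -/
theorem exists_continuousMulEquiv_of_ker_eq {G H₁ H₂ : Type*} [Group G] [TopologicalSpace G]
    [CompactSpace G] [Group H₁] [TopologicalSpace H₁] [T2Space H₁] [Group H₂] [TopologicalSpace H₂]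
    [T2Space H₂] (f₁ : G →* H₁) (f₂ : G →* H₂) (h₁ : Continuous f₁) (h₂ : Continuous f₂)
    (hs₁ : Function.Surjective f₁) (hs₂ : Function.Surjective f₂) (hker : f₁.ker = f₂.ker) :
    ∃ e : H₁ ≃ₜ* H₂, ∀ g, e (f₁ g) = f₂ g := by
  have hq : IsQuotientMap f₁ := h₁.isClosedMap.isQuotientMap h₁ hs₁
  have : CompactSpace H₁ := hs₁.compactSpace h₁
  let f : H₁ →* H₂ := f₁.liftOfSurjective hs₁ ⟨f₂, hker.le⟩
  have hf (g : G) : f (f₁ g) = f₂ g := MonoidHom.liftOfRightInverse_comp_apply _ _ _ _ g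
  refine ⟨continuousMulEquivOfBijective f (hq.continuous_iff.2 ?_) ⟨?_, fun y ↦ ?_⟩, hf⟩
  · exact (funext hf : f ∘ f₁ = f₂) ▸ h₂
  · rw [injective_iff_map_eq_one]
    intro x hx
    obtain ⟨g, rfl⟩ := hs₁ x
    rw [hf] at hx
    exact hker.ge hx
  · obtain ⟨g, rfl⟩ := hs₂ y
    exact ⟨f₁ g, hf g⟩

variable {R K Ω : Type*} [CommRing R] [IsDomain R] [IsDiscreteValuationRing R]
  [IsAdicComplete (maximalIdeal R) R] [Field K] [Algebra R K] [IsFractionRing R K]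
  [Field Ω] [Algebra K Ω] [Algebra R Ω] [IsScalarTower R K Ω]

attribute [local instance] resField_isIntegral

variable (R K Ω) in
/-- The reduction map has a continuous section. -/
theorem exists_section_reduction [IsGalois K Ω] [IsSepClosed Ω]
    (p : ℕ) [Fact p.Prime] [CharP (ResidueField R) p] :
    ∃ s : Gal(resField R Ω/ResidueField R) →ₜ* Gal(Ω/K), ∀ τ, reduction R K Ω (s τ) = τ := by
  have := charP_resField R Ω p
  have : FaithfulSMul R Ω :=
    (faithfulSMul_iff_algebraMap_injective R Ω).2 (algebraMap_injective_of_tower R K Ω)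
  have := resField_isAlgClosed R Ω p
  obtain ⟨ϖ, hϖ⟩ := IsDiscreteValuationRing.exists_irreducible R
  obtain ⟨ρ, m, hm, hρ, hdvd⟩ := exists_root_sequence (R := R) p (algebraMap R Ω ϖ)
  -- the closed subgroup fixing the tame tower still maps onto the Galois group of the residue
  -- field, and the kernel of this map is pro-`p`
  let H₀ : Subgroup Gal(Ω/K) := ⨅ i, MulAction.stabilizer Gal(Ω/K) (ρ i)
  have hH₀ (σ : Gal(Ω/K)) : σ ∈ H₀ ↔ ∀ i, σ (ρ i) = ρ i := Subgroup.mem_iInf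
  have hclosed : IsClosed (H₀ : Set Gal(Ω/K)) := by
    rw [Subgroup.coe_iInf]
    exact isClosed_iInter fun i ↦ isClosed_setOf_apply_eq (ρ i) (ρ i)
  have : CompactSpace H₀ := isCompact_iff_compactSpace.1 hclosed.isCompact
  let f : H₀ →* Gal(resField R Ω/ResidueField R) := (reduction R K Ω).comp H₀.subtype
  have hf : Continuous f := (continuous_reduction R K Ω).comp continuous_subtype_val
  have hfs : Function.Surjective f := by
    intro τ
    obtain ⟨g, rfl⟩ := reduction_surjective R K Ω τ
    obtain ⟨h, h1, h2⟩ := exists_fixes_root_sequence hϖ hm hρ g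
    refine ⟨⟨h, (hH₀ h).2 h1⟩, ?_⟩
    change reduction R K Ω h = reduction R K Ω g
    rw [← inv_mul_eq_one, ← map_inv, ← map_mul]
    refine reduction_eq_one_of_fixes_maxUnramified p _ fun x hx ↦ ?_
    rw [AlgEquiv.mul_apply, ← h2 x hx]
    exact h.symm_apply_apply x
  let _ : MulSemiringAction H₀ (resField R Ω) := MulSemiringAction.compHom _ f
  obtain ⟨H, hH, hHs, hH1⟩ := exists_closed_complement (G := H₀) (F := resField R Ω) p
    (fun x ↦ (isOpen_stabilizer_reduction R K x).preimage continuous_subtype_val)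
    (fun σ hσ ↦ by
      rw [tendsto_subtype_rng]
      refine tendsto_pow_of_reduction_eq_one p hϖ σ.1 (AlgEquiv.ext hσ) fun n hn ↦ ?_
      obtain ⟨i, l, hl⟩ := hdvd n hn
      refine ⟨ρ i ^ l, ?_, ?_⟩
      · rw [← pow_mul, mul_comm, ← hl, (hm i).2]
      · rw [map_pow, (hH₀ σ.1).1 σ.2])
  have : CompactSpace H := isCompact_iff_compactSpace.1 hH.isCompact
  let e := continuousMulEquivOfBijective (f.comp H.subtype) (hf.comp continuous_subtype_val) (by
    constructor
    · rw [injective_iff_map_eq_one]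
      intro h hh
      exact Subtype.ext (hH1 h h.2 (DFunLike.congr_fun hh))
    · intro τ
      obtain ⟨g, rfl⟩ := hfs τ
      obtain ⟨h, hh, hgh⟩ := hHs g
      exact ⟨⟨h, hh⟩, AlgEquiv.ext hgh⟩)
  refine ⟨⟨(H₀.subtype.comp H.subtype).comp e.symm.toMulEquiv.toMonoidHom, ?_⟩, fun τ ↦ ?_⟩
  · exact (continuous_subtype_val.comp continuous_subtype_val).comp e.symm.continuous
  · exact e.apply_symm_apply τ

variable (R K Ω) in
theorem ker_restriction_eq_ker_reduction [IsSepClosure K Ω]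
    (p : ℕ) [Fact p.Prime] [CharP (ResidueField R) p] :
    (restriction R K Ω).ker = (reduction R K Ω).ker := by
  have : IsSepClosed Ω := IsSepClosure.sep_closed K
  have : Algebra.IsSeparable K Ω := IsSepClosure.separable
  ext σ
  rw [restriction, IntermediateField.restrictNormalHom_ker,
    IntermediateField.mem_fixingSubgroup_iff, MonoidHom.mem_ker]
  exact ⟨reduction_eq_one_of_fixes_maxUnramified p σ, fixes_maxUnramified_of_reduction_eq_one σ⟩

end Splitting

end CompleteDVF

theorem mainTheorem6 (p : ℕ) [Fact p.Prime]
    (R : Type*) [CommRing R] [IsDomain R] [IsDiscreteValuationRing R]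
    [IsAdicComplete (IsLocalRing.maximalIdeal R) R]
    [CharP (IsLocalRing.ResidueField R) p]
    (K : Type*) [Field K] [Algebra R K] [IsFractionRing R K]
    (Ksep : Type*) [Field Ksep] [Algebra K Ksep] [IsSepClosure K Ksep]
    [Algebra R Ksep] [IsScalarTower R K Ksep] :
    (∃ s : Gal(CompleteDVF.maxUnramified R K Ksep/K) →ₜ* Gal(Ksep/K),
      ∀ σ, CompleteDVF.restriction R K Ksep (s σ) = σ) ∧
    IsAlgClosure (IsLocalRing.ResidueField R) (CompleteDVF.resField R Ksep) ∧
    (∃ e : Gal(CompleteDVF.maxUnramified R K Ksep/K) ≃ₜ*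
        Gal(CompleteDVF.resField R Ksep/IsLocalRing.ResidueField R),
      ∀ σ, e (CompleteDVF.restriction R K Ksep σ) = CompleteDVF.reduction R K Ksep σ) ∧
    (∃ s : Gal(CompleteDVF.resField R Ksep/IsLocalRing.ResidueField R) →ₜ* Gal(Ksep/K),
      ∀ τ, CompleteDVF.reduction R K Ksep (s τ) = τ) := by
  open CompleteDVF in
  have : IsGalois K Ksep := IsSepClosure.isGalois
  have : IsSepClosed Ksep := IsSepClosure.sep_closed K
  have := resField_isIntegral R Ksep
  have : FaithfulSMul R Ksep :=
    (faithfulSMul_iff_algebraMap_injective R Ksep).2 (algebraMap_injective_of_tower R K Ksep)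
  obtain ⟨e, he⟩ := exists_continuousMulEquiv_of_ker_eq (restriction R K Ksep)
    (reduction R K Ksep) (InfiniteGalois.restrictNormalHom_continuous _)
    (continuous_reduction R K Ksep) (AlgEquiv.restrictNormalHom_surjective Ksep)
    (reduction_surjective R K Ksep) (ker_restriction_eq_ker_reduction R K Ksep p)
  obtain ⟨s, hs⟩ := exists_section_reduction R K Ksep p
  refine ⟨⟨s.comp (e : _ →ₜ* _), fun σ ↦ e.injective ?_⟩,
    ⟨resField_isAlgClosed R Ksep p, inferInstance⟩, ⟨e, he⟩, s, hs⟩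
  -- transported along `e`, the section of the reduction map becomes one of the restriction map
  rw [he]
  exact hs (e σ)
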